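/- Let $\mathcal N$ be a Bayesian network structure (a DAG $\mathcal G$) on finitely many discrete variables $V_1,\dots,V_n$ with finite nonempty domains, and let $\mathbb C_{\mathcal N}[\mathcal C]$ be a credal Bayesian network (CrBN) on it: for every variable $V_i$ and every instantiation $u$ of its parents a nonempty set $\mathcal C_{V_i\mid u}$ of probability vectors on the domain of $V_i$ is given, and $\mathcal C=\prod_{V_i,u}\mathcal C_{V_i\mid u}$. For an event $e$ (an instantiation of a subset of the variables) put $\mathrm{MAR}_{\max}(\mathcal N,\mathcal C,e)=\max_{\Theta\in\mathcal C}p_{\mathcal N_\Theta}(e)$ (a supremum if it is not attained). Let $\sigma=(V_1,\dots,V_n)$ be a topological ordering of $\mathcal G$. Let $\mathcal T$ be any arithmetic circuit (a finite rooted DAG of $+$- and $\times$-nodes, whose leaves are indicators $\lambda_v$ and parameters $\theta_{v\mid u}$) that is smooth, decomposable and deterministic and computes $\mathcal N$ respecting $\sigma$, that is: (1) the sum over all complete subcircuits of $\mathcal T$ of the product of their leaves equals the network polynomial $\sum_{v_1,\dots,v_n}\prod_i\theta_{v_i\mid u_i}\lambda_{v_i}$; (2) every $+$-node $t$ splits on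 some variable $V=\mathrm{split}(t)$, that is, its children correspond one-to-one to the values $v$ of $V$ so that every complete subcircuit of the child for $v$ contains $\lambda_v$; (3) if the $+$-node $t'$ is a proper descendant of the $+$-node $t$, then $\mathrm{split}(t)$ comes before $\mathrm{split}(t')$ in $\sigma$. Compile $\mathcal T$ to a credal sum-product network (CSPN) $\mathbb C_{\mathcal S}[\mathcal C_{\mathcal S}]$ as follows. Remove all parameter nodes. At each sum node $t$ splitting on $V$, let $u$ be the instantiation of the parents of $V$ in which each parent $U$ takes the unique value on which the parameter nodes below $t$ condition (if the domain of $V$ has one element, $u$ is immaterial). Label the branch of $t$ for the value $v$ with the weight $\theta_{v\mid u}$, and let the weight vector of $t$ range over $\mathcal C_{V\mid u}$, independently of all other sum nodes. Let $\mathrm{MAR}_{\max}(\mathcal S,\mathcal C_{\mathcal S},e)=\max_{W\in\mathcal C_{\mathcal S}}l_{\mathcal S}[\lambda_e,W]$, where $l_{\mathcal S}[\lambda,W]$ is the sum over the complete subcircuits of $\mathcal S$ of the product of their indicators and of the weights of their chosen branches, and $\lambda_e$ sets an indicator to $0$ if it contradicts $e$ and to $1$ otherwise. This is the number returned by the upper-bounding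 algorithm run with the ordering $\sigma$. Let $\mathbb C_{\mathcal N^+_\sigma}[\mathcal C^+_\sigma]$ be the maximal structural enrichment of the CrBN for $\sigma$: the CrBN in which the parents of each variable $V_i$ are all the variables earlier in $\sigma$, with credal sets $\mathcal C^+_{V_i\mid u,w}=\mathcal C_{V_i\mid u}$ for every instantiation $u$ of the original parents and $w$ of the added parents of $V_i$. Then for every event $e$ $$\mathrm{MAR}_{\max}(\mathcal S,\mathcal C_{\mathcal S},e)=\mathrm{MAR}_{\max}(\mathcal N^+_\sigma,\mathcal C^+_\sigma,e).$$ Both sides are finite suprema, one of them is attained if and only if the other is, and both are attained if all the sets $\mathcal C_{V_i\mid u}$ are closed. -/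

import Mathlib

namespace CredalNet

noncomputable section

/-! ### Bayesian network structures, credal Bayesian networks, and their enrichments -/

/-- A directed acyclic graph on the variables `ι`, given by the parents of each variable. -/
structure BNGraph (ι : Type*) where
  pa : ι → Finset ι
  acyclic : ∀ i, ¬ Relation.TransGen (fun j k => j ∈ pa k) i i

/-- The bijection `σ` lists the variables in a topological order: parents come first. -/
def BNGraph.IsTopologicalOrder {ι : Type*} (G : BNGraph ι) {n : ℕ} (σ : ι ≃ Fin n) : Prop :=
  ∀ i, ∀ j ∈ G.pa i, σ j < σ i

/-- Instantiations of the parents of the variable `i`. -/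
abbrev BNGraph.ParentInst {ι : Type*} (G : BNGraph ι) (Ω : ι → Type*) (i : ι) : Type _ :=
  ∀ j : G.pa i, Ω j

/-- Parameters `Θ i u x = θ_{x | u}` of a Bayesian network with graph `G`; the variable `i` has
the finite domain `Ω i`. -/
abbrev BNGraph.Params {ι : Type*} (G : BNGraph ι) (Ω : ι → Type*) : Type _ :=
  ∀ i, G.ParentInst Ω i → Ω i → ℝ

/-- The probability `p(e) = ∑_{v ∼ e} ∏_i θ_{v_i | u_i}` of the event `e`, an instantiation of the
set `E` of variables. -/
def BNGraph.prob {ι : Type*} [Fintype ι] [DecidableEq ι] (G : BNGraph ι)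
    {Ω : ι → Type*} [∀ i, Fintype (Ω i)] (Θ : G.Params Ω) {E : Finset ι} (e : ∀ i : E, Ω i) : ℝ :=
  open Classical in
  ∑ v : (∀ i, Ω i), if (∀ i : E, v i = e i) then ∏ i, Θ i (fun j => v j) (v i) else 0

/-- A credal Bayesian network: a graph, and for each variable `i` and instantiation `u` of its
parents a nonempty set of probability vectors on the domain of `i`. -/
structure CredalBN (ι : Type*) (Ω : ι → Type*) [∀ i, Fintype (Ω i)] extends BNGraph ι where
  credal : ∀ i, toBNGraph.ParentInst Ω i → Set (Ω i → ℝ)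
  credal_subset : ∀ i u, credal i u ⊆ stdSimplex ℝ (Ω i)
  credal_nonempty : ∀ i u, (credal i u).Nonempty

namespace CredalBN

variable {ι : Type*} {Ω : ι → Type*} [∀ i, Fintype (Ω i)]

/-- The credal set of the network: the product of all the local credal sets. -/
def params (N : CredalBN ι Ω) : Set (N.toBNGraph.Params Ω) :=
  {Θ | ∀ i u, Θ i u ∈ N.credal i u}

/-- The probabilities of the event `e` under the members of the credal family. -/
def marValues [Fintype ι] [DecidableEq ι] (N : CredalBN ι Ω) {E : Finset ι}
    (e : ∀ i : E, Ω i) : Set ℝ :=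
  (fun Θ => N.toBNGraph.prob Θ e) '' N.params

/-- The maximum marginal probability of the event `e`. -/
def marMax [Fintype ι] [DecidableEq ι] (N : CredalBN ι Ω) {E : Finset ι}
    (e : ∀ i : E, Ω i) : ℝ :=
  sSup (N.marValues e)

/-- The structural enrichment of `N` with underlying graph `G'`, a graph with more edges:
`C'_{V_i | u_i, w_i} = C_{V_i | u_i}`. -/
def enrich (N : CredalBN ι Ω) (G' : BNGraph ι) (h : ∀ i, N.pa i ⊆ G'.pa i) : CredalBN ι Ω where
  toBNGraph := G'
  credal i u := N.credal i (fun j => u ⟨j, h i j.2⟩)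
  credal_subset i _ := N.credal_subset i _
  credal_nonempty i _ := N.credal_nonempty i _

end CredalBN

/-- The graph in which the parents of each variable are all the variables earlier in `σ`. -/
def completeGraph {ι : Type*} [Fintype ι] {n : ℕ} (σ : ι ≃ Fin n) : BNGraph ι where
  pa i := Finset.univ.filter (fun j => σ j < σ i)
  acyclic i h := by
    have key : ∀ a b, Relation.TransGen
        (fun j k => j ∈ Finset.univ.filter (fun j => σ j < σ k)) a b → σ a < σ b := by
      intro a b hab
      induction hab with
      | single h => simpa using h
      | tail _ h ih => exact ih.trans (by simpa using h)
    exact lt_irrefl _ (key i i h)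

/-- The maximal structural enrichment of `N` for the topological order `σ`. -/
def CredalBN.maximalEnrichment {ι : Type*} {Ω : ι → Type*} [∀ i, Fintype (Ω i)] [Fintype ι]
    (N : CredalBN ι Ω) {n : ℕ} (σ : ι ≃ Fin n) (hσ : N.toBNGraph.IsTopologicalOrder σ) :
    CredalBN ι Ω :=
  N.enrich (completeGraph σ) (fun i j hj => by simpa [completeGraph] using hσ i j hj)

/-! ### Circuits and their complete subcircuits -/

/-- The label of a circuit node: a leaf carries a label from `L`, an internal node is a sum node
or a product node. -/
inductive NodeKind (L : Type*) where
  | leaf (l : L)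
  | sum
  | prod

/-- A circuit: a finite rooted directed acyclic graph with labelled nodes. The edges that leave the
node `t` are indexed by the finite type `Branch t`. -/
structure Circuit (L : Type*) where
  Node : Type
  Branch : Node → Type
  child : ∀ t, Branch t → Node
  kind : Node → NodeKind L
  root : Node
  nodeFinite : Finite Node
  branchFintype : ∀ t, Fintype (Branch t)
  leaf_isEmpty : ∀ t l, kind t = .leaf l → IsEmpty (Branch t)
  acyclic : WellFounded (fun s t => ∃ b, child t b = s)
  rooted : ∀ t, Relation.ReflTransGen (fun s s' => ∃ b, child s b = s') root t

attribute [instance] Circuit.branchFintype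

namespace Circuit

variable {L : Type*} (T : Circuit L)

/-- `T.Edge s t`: there is an edge from `s` to its child `t`. -/
def Edge (s t : T.Node) : Prop := ∃ b, T.child s b = t

/-- The sum nodes. -/
abbrev SumNode : Type := {t : T.Node // T.kind t = .sum}

/-- Complete subcircuits of the part of the circuit below `t`: going down from `t`, choose one child
of each visited sum node and take all children of each visited product node. -/
inductive Subcircuit : T.Node → Type _ where
  | leaf {t : T.Node} {l : L} (h : T.kind t = .leaf l) : Subcircuit t
  | sum {t : T.Node} (h : T.kind t = .sum) (b : T.Branch t)
      (α : Subcircuit (T.child t b)) : Subcircuit t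
  | prod {t : T.Node} (h : T.kind t = .prod)
      (α : ∀ b, Subcircuit (T.child t b)) : Subcircuit t

variable {T}

/-- The labels of the leaves that a complete subcircuit visits. -/
def Subcircuit.leaves : {t : T.Node} → T.Subcircuit t → Multiset L
  | _, .leaf (l := l) _ => {l}
  | _, .sum _ _ α => α.leaves
  | _, .prod _ α => ∑ b, (α b).leaves

/-- The edges below sum nodes that a complete subcircuit chooses. -/
def Subcircuit.choices :
    {t : T.Node} → T.Subcircuit t → Multiset ((s : T.SumNode) × T.Branch s)
  | _, .leaf _ => 0
  | t, .sum h b α => ⟨⟨t, h⟩, b⟩ ::ₘ α.choices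
  | _, .prod _ α => ∑ b, (α b).choices

theorem Subcircuit.finite (t : T.Node) : Finite (T.Subcircuit t) := by
  induction t using T.acyclic.induction with
  | _ t ih =>
    have ih' : ∀ b, Finite (T.Subcircuit (T.child t b)) := fun b => ih _ ⟨b, rfl⟩
    cases hk : T.kind t with
    | leaf l =>
      refine Finite.of_surjective (α := Unit) (fun _ => .leaf hk) ?_
      intro α
      cases α with
      | leaf h =>
        have := hk.symm.trans h
        cases this
        exact ⟨(), rfl⟩
      | sum h => simp [hk] at h
      | prod h => simp [hk] at h
    | sum =>
      refine Finite.of_surjective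
        (fun p : (b : T.Branch t) × T.Subcircuit (T.child t b) => .sum hk p.1 p.2) ?_
      intro α
      cases α with
      | leaf h => simp [hk] at h
      | sum h b α => exact ⟨⟨b, α⟩, rfl⟩
      | prod h => simp [hk] at h
    | prod =>
      refine Finite.of_surjective
        (fun p : (∀ b, T.Subcircuit (T.child t b)) => .prod hk p) ?_
      intro α
      cases α with
      | leaf h => simp [hk] at h
      | sum h => simp [hk] at h
      | prod h α => exact ⟨α, rfl⟩

instance (t : T.Node) : Fintype (T.Subcircuit t) :=
  @Fintype.ofFinite _ (Subcircuit.finite t)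

end Circuit

/-! ### Arithmetic circuits -/

/-- The variables of the network polynomial: the indicators `λ_x`, for `x` in the domain of `i`, and
the parameters `θ_{x | u}`. -/
inductive ACLabel {ι : Type*} (G : BNGraph ι) (Ω : ι → Type*) where
  | ind (i : ι) (x : Ω i)
  | par (i : ι) (x : Ω i) (u : G.ParentInst Ω i)

/-- The network polynomial `∑_v ∏_i θ_{v_i | u_i} λ_{v_i}`. -/
def BNGraph.networkPoly {ι : Type*} [Fintype ι] [DecidableEq ι] (G : BNGraph ι)
    (Ω : ι → Type*) [∀ i, Fintype (Ω i)] : MvPolynomial (ACLabel G Ω) ℝ :=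
  ∑ v : (∀ i, Ω i), ∏ i,
    MvPolynomial.X (ACLabel.par i (v i) (fun j => v j)) * MvPolynomial.X (ACLabel.ind i (v i))

/-- Arithmetic circuits over the variables and parameters of a Bayesian network. -/
abbrev AC {ι : Type*} (G : BNGraph ι) (Ω : ι → Type*) : Type _ := Circuit (ACLabel G Ω)

namespace AC

variable {ι : Type*} {G : BNGraph ι} {Ω : ι → Type*}

/-- The polynomial of an arithmetic circuit: the sum of the terms of its complete subcircuits. -/
def poly (T : AC G Ω) : MvPolynomial (ACLabel G Ω) ℝ :=
  ∑ α : T.Subcircuit T.root, (α.leaves.map MvPolynomial.X).prod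

/-- The variables that have an indicator at or below the node `t`. -/
def vars (T : AC G Ω) (t : T.Node) : Set ι :=
  {i | ∃ t' x, Relation.ReflTransGen T.Edge t t' ∧ T.kind t' = .leaf (.ind i x)}

/-- The children of a sum node mention the same variables. -/
def Smooth (T : AC G Ω) : Prop :=
  ∀ t, T.kind t = .sum → ∀ b b', vars T (T.child t b) = vars T (T.child t b')

/-- Distinct children of a product node mention disjoint sets of variables. -/
def Decomposable (T : AC G Ω) : Prop :=
  ∀ t, T.kind t = .prod → ∀ b b', b ≠ b' →
    Disjoint (vars T (T.child t b)) (vars T (T.child t b'))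

/-- For every instantiation `v` of all variables, at most one child of a sum node has a complete
subcircuit whose indicators all agree with `v`. -/
def Deterministic (T : AC G Ω) : Prop :=
  ∀ t, T.kind t = .sum → ∀ v : (∀ i, Ω i), ∀ b b',
    (∃ α : T.Subcircuit (T.child t b), ∀ i x, .ind i x ∈ α.leaves → x = v i) →
    (∃ α : T.Subcircuit (T.child t b'), ∀ i x, .ind i x ∈ α.leaves → x = v i) → b = b'

/-- Every sum node `t` splits on a variable `var t`: its children are in bijection with the domain
of that variable, and all complete subcircuits of the child for the value `x` contain `λ_x`. -/
structure Splitting (T : AC G Ω) where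
  var : T.SumNode → ι
  val : ∀ t : T.SumNode, T.Branch t ≃ Ω (var t)
  contains : ∀ (t : T.SumNode) (b : T.Branch t) (α : T.Subcircuit (T.child t b)),
    .ind (var t) (val t b) ∈ α.leaves

/-- The arithmetic circuit `T`, whose sum nodes split as recorded in `sp`, computes the Bayesian
network with graph `G` respecting the order `σ`. -/
structure Computes [Fintype ι] [DecidableEq ι] [∀ i, Fintype (Ω i)] (T : AC G Ω)
    (sp : Splitting T) {n : ℕ} (σ : ι ≃ Fin n) : Prop where
  smooth : Smooth T
  decomposable : Decomposable T
  deterministic : Deterministic T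
  poly_eq : poly T = G.networkPoly Ω
  ordered : ∀ t t' : T.SumNode, Relation.TransGen T.Edge t.1 t'.1 →
    σ (sp.var t) < σ (sp.var t')

/-- The parameter nodes. -/
def IsParam (T : AC G Ω) (t : T.Node) : Prop :=
  ∃ i x u, T.kind t = .leaf (.par i x u)

/-- The values `w` of the variable `j` such that a parameter node `θ_{x | u}` at or below `t`
conditions on `j = w`. -/
def possibleValues (T : AC G Ω) (t : T.Node) (j : ι) : Set (Ω j) :=
  {w | ∃ t', Relation.ReflTransGen T.Edge t t' ∧
    ∃ (i : ι) (x : Ω i) (u : G.ParentInst Ω i) (h : j ∈ G.pa i),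
      T.kind t' = .leaf (.par i x u) ∧ u ⟨j, h⟩ = w}

/-- The values of the parents of the split variable at the sum node `t`: for each parent `j`, the
unique element of `possibleValues T t j`. (It can fail to exist only if the split variable has a
one-point domain; then the choice is immaterial, as the only probability vector is `1`.) -/
def parentValues [∀ i, Nonempty (Ω i)] (T : AC G Ω) (sp : Splitting T) (t : T.SumNode) :
    G.ParentInst Ω (sp.var t) :=
  fun j => Classical.epsilon (fun w => w ∈ possibleValues T t.1 j)

theorem Computes.root_not_isParam [Fintype ι] [DecidableEq ι] [∀ i, Fintype (Ω i)] {T : AC G Ω}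
    {sp : Splitting T} {n : ℕ} {σ : ι ≃ Fin n} (hT : Computes T sp σ) : ¬ IsParam T T.root := by
  rintro ⟨i, x, u, hk⟩
  have hp : ∀ α : T.Subcircuit T.root, α.leaves = {ACLabel.par i x u} := by
    intro α
    cases α with
    | leaf h =>
      have := hk.symm.trans h
      cases this
      simp [Circuit.Subcircuit.leaves]
    | sum h => simp [hk] at h
    | prod h => simp [hk] at h
  have h1 := congrArg (MvPolynomial.eval
    (fun l : ACLabel G Ω => match l with | .ind _ _ => (0 : ℝ) | .par _ _ _ => 1)) hT.poly_eq
  have : Nonempty (T.Subcircuit T.root) := ⟨.leaf hk⟩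
  have hc : (Fintype.card (T.Subcircuit T.root) : ℝ) ≠ 0 := by
    exact_mod_cast Fintype.card_ne_zero
  have : Nonempty ι := ⟨i⟩
  have hι : Fintype.card ι ≠ 0 := Fintype.card_ne_zero
  simp [poly, BNGraph.networkPoly, hp, hι] at h1

end AC

/-! ### Sum-product networks -/

/-- Sum-product networks over variables with domains `Ω i`: the leaves are indicators; the weights
sit on the branches of the sum nodes. -/
abbrev SPN {ι : Type*} (Ω : ι → Type*) : Type _ := Circuit ((i : ι) × Ω i)

namespace SPN

variable {ι : Type*} {Ω : ι → Type*}

/-- The weights of the branches of the sum nodes. -/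
abbrev Weights (S : SPN Ω) : Type := ∀ s : S.SumNode, S.Branch s → ℝ

/-- The polynomial of the network: the sum, over the complete subcircuits, of the product of the
visited indicators and of the weights of the chosen branches. -/
def poly (S : SPN Ω) (lam : ∀ i, Ω i → ℝ) (W : Weights S) : ℝ :=
  ∑ α : S.Subcircuit S.root,
    (α.leaves.map (fun l => lam l.1 l.2)).prod * (α.choices.map (fun c => W c.1 c.2)).prod

end SPN

/-- The values of the indicators for the event `e`. -/
def eventIndicators {ι : Type*} {Ω : ι → Type*} {E : Finset ι} (e : ∀ i : E, Ω i) (i : ι)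
    (x : Ω i) : ℝ :=
  open Classical in
  if ∀ h : i ∈ E, x = e ⟨i, h⟩ then 1 else 0

/-- A credal sum-product network: each sum node has its own set of weight vectors, a subset of the
probability simplex, and the weights of different sum nodes vary independently. -/
structure CredalSPN {ι : Type*} (Ω : ι → Type*) where
  spn : SPN Ω
  credal : ∀ s : spn.SumNode, Set (spn.Branch s → ℝ)
  credal_subset : ∀ s, credal s ⊆ stdSimplex ℝ (spn.Branch s)

namespace CredalSPN

variable {ι : Type*} {Ω : ι → Type*}

/-- The credal set of the network: the product of the credal sets of the sum nodes. -/
def weights (S : CredalSPN Ω) : Set (SPN.Weights S.spn) :=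
  {W | ∀ s, W s ∈ S.credal s}

/-- The values of the polynomial at the event `e` for the weights in the credal set. -/
def marValues (S : CredalSPN Ω) {E : Finset ι} (e : ∀ i : E, Ω i) : Set ℝ :=
  (fun W => SPN.poly S.spn (eventIndicators e) W) '' S.weights

/-- The maximum marginal probability of the event `e`. -/
def marMax (S : CredalSPN Ω) {E : Finset ι} (e : ∀ i : E, Ω i) : ℝ :=
  sSup (S.marValues e)

end CredalSPN

/-! ### Compilation of an arithmetic circuit to a (credal) sum-product network -/

namespace AC

variable {ι : Type*} {G : BNGraph ι} {Ω : ι → Type*}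

/-- The label of a node after the compilation. (The case of parameter nodes does not occur.) -/
def compileKind : NodeKind (ACLabel G Ω) → NodeKind ((i : ι) × Ω i)
  | .leaf (.ind i x) => .leaf ⟨i, x⟩
  | .leaf (.par _ _ _) => .prod
  | .sum => .sum
  | .prod => .prod

theorem compileKind_eq_sum {k : NodeKind (ACLabel G Ω)} (h : compileKind k = .sum) :
    k = .sum := by
  rcases k with (_ | _) | _ | _ <;> simp_all [compileKind]

/-- Remove all parameter nodes. -/
def compile (T : AC G Ω) (hroot : ¬ IsParam T T.root) : SPN Ω where
  Node := {t : T.Node // ¬ IsParam T t}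
  Branch t := {b : T.Branch t.1 // ¬ IsParam T (T.child t.1 b)}
  child t b := ⟨T.child t.1 b.1, b.2⟩
  kind t := compileKind (T.kind t.1)
  root := ⟨T.root, hroot⟩
  nodeFinite := by
    have := T.nodeFinite
    infer_instance
  branchFintype t := by
    classical
    infer_instance
  leaf_isEmpty t l h := by
    cases hk : T.kind t.1 with
    | leaf l' =>
      have := T.leaf_isEmpty t.1 l' hk
      infer_instance
    | sum => simp [hk, compileKind] at h
    | prod => simp [hk, compileKind] at h
  acyclic := by
    refine Subrelation.wf ?_ (InvImage.wf Subtype.val T.acyclic)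
    rintro s t ⟨b, hb⟩
    exact ⟨b.1, congrArg Subtype.val hb⟩
  rooted := by
    rintro ⟨t, ht⟩
    have hr := T.rooted t
    induction hr with
    | refl => exact .refl
    | @tail s t' _ hst ih =>
      obtain ⟨b, hb⟩ := hst
      subst hb
      have hs : ¬ IsParam T s := by
        rintro ⟨i, x, u, hk⟩
        exact (T.leaf_isEmpty s _ hk).false b
      exact (ih hs).tail ⟨⟨b, ht⟩, rfl⟩

/-- The sum node of the arithmetic circuit from which a sum node of the compiled network comes. -/
def origin (T : AC G Ω) (hroot : ¬ IsParam T T.root) (s : (compile T hroot).SumNode) :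
    T.SumNode :=
  ⟨s.1.1, compileKind_eq_sum s.2⟩

theorem Splitting.child_not_isParam {T : AC G Ω} (sp : Splitting T) (t : T.SumNode)
    (b : T.Branch t) : ¬ IsParam T (T.child t b) := by
  rintro ⟨i, x, u, hk⟩
  have := sp.contains t b (.leaf hk)
  simp [Circuit.Subcircuit.leaves] at this

/-- The compiled credal sum-product network. At a sum node that splits on `V`, with parent values
`u`, the branch for the value `x` carries the weight `θ_{x | u}`, and the credal set of the node is
`C_{V | u}`, independently of all other sum nodes. -/
def compileCredal [∀ i, Fintype (Ω i)] [∀ i, Nonempty (Ω i)] (N : CredalBN ι Ω)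
    (T : AC N.toBNGraph Ω) (sp : Splitting T) (hroot : ¬ IsParam T T.root) : CredalSPN Ω where
  spn := compile T hroot
  credal s := {w | ∃ θ ∈ N.credal (sp.var (origin T hroot s))
      (parentValues T sp (origin T hroot s)), ∀ b, w b = θ (sp.val (origin T hroot s) b.1)}
  credal_subset s := by
    rintro w ⟨θ, hθ, hw⟩
    have hs := N.credal_subset _ _ hθ
    refine ⟨fun b => by rw [hw]; exact hs.1 _, ?_⟩
    rw [← hs.2]
    let f : (compile T hroot).Branch s.1 ≃ Ω (sp.var (origin T hroot s)) :=
      (Equiv.subtypeUnivEquiv (fun b => sp.child_not_isParam (origin T hroot s) b)).trans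
        (sp.val (origin T hroot s))
    exact Fintype.sum_equiv f _ _ (fun b => hw b)

end AC

end

end CredalNet

/-! ### Complete subcircuits: constructors, exchange and existence -/

namespace CredalNet

namespace Circuit

variable {L : Type*} {T : Circuit L}

namespace Subcircuit

/-! The polynomial identity makes complete subcircuits of the circuit correspond bijectively to
instantiations `v` (`chosen_bijective`): the subcircuit of `v` takes at each visited sum node the
branch prescribed by `v`, and its leaves are exactly the term of `v`. It splits on every variable
with at least two values, and on no variable twice. By the ordering condition, the node at which it
splits on `V` depends only on the values of the variables before `V`. Exchanging parts of
subcircuits below a sum node (`exchange`) shows that the parent values read off below a visited node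
are those of the visiting instantiation (`credal_parentValues`).

Hence a weight choice for the sum nodes is a choice of conditional distributions given the full
past, taken from the right credal sets: it is a member of the maximal enrichment with the same value
(`exists_params_of_weights`, `value_root_eq_expectation`). This gives one inequality.

A member `Θ` of the enrichment may behave differently on two pasts that lead to the same sum node,
so it need not come from weights. But what can be gained below a node does not depend on how the
node was reached. Choose at each node, from the bottom up, the best among the finitely many vectors
that `Θ` offers there over all visiting pasts (`exists_optimal_weights`). The resulting weights
induce some `Θ'`. Now turn `Θ'` into `Θ` one variable at a time, in the order of `σ`. When position
`k` is changed, all later variables still follow the optimal weights, so for each fixed past the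
change replaces an optimal vector by a competitor and cannot increase the value
(`exists_weights_of_params`). Both sets of attainable values therefore have the same upper bounds
and the same maxima, if any. -/

theorem leaf_bijective {t : T.Node} {l : L} (h : T.kind t = .leaf l) :
    Function.Bijective (fun _ : Unit => (Subcircuit.leaf h : T.Subcircuit t)) := by
  refine ⟨fun _ _ _ => rfl, fun α => ?_⟩
  cases α with
  | leaf h' => cases h.symm.trans h'; exact ⟨(), rfl⟩
  | sum h' => simp [h] at h'
  | prod h' => simp [h] at h'

theorem sum_bijective {t : T.Node} (h : T.kind t = .sum) :
    Function.Bijective (fun p : (b : T.Branch t) × T.Subcircuit (T.child t b) =>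
      (Subcircuit.sum h p.1 p.2 : T.Subcircuit t)) := by
  refine ⟨fun p q hpq => ?_, fun α => ?_⟩
  · obtain ⟨b, α⟩ := p
    obtain ⟨b', α'⟩ := q
    simpa using hpq
  · cases α with
    | leaf h' => simp [h] at h'
    | sum h' b α => exact ⟨⟨b, α⟩, rfl⟩
    | prod h' => simp [h] at h'

theorem prod_bijective {t : T.Node} (h : T.kind t = .prod) :
    Function.Bijective (fun p : ∀ b, T.Subcircuit (T.child t b) =>
      (Subcircuit.prod h p : T.Subcircuit t)) := by
  refine ⟨fun p q hpq => by simpa using hpq, fun α => ?_⟩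
  cases α with
  | leaf h' => simp [h] at h'
  | sum h' => simp [h] at h'
  | prod h' α => exact ⟨α, rfl⟩

/-- The sum nodes chosen by a complete subcircuit below `t` are reachable from `t`. -/
theorem reachable_of_mem_choices {t : T.Node} (α : T.Subcircuit t) :
    ∀ c ∈ α.choices, Relation.ReflTransGen T.Edge t c.1.1 := by
  induction α with
  | leaf h => simp [choices]
  | sum h b α ih =>
    intro c hc
    rcases Multiset.mem_cons.1 hc with rfl | hc
    · exact .refl
    · exact .head ⟨b, rfl⟩ (ih c hc)
  | prod h α ih =>
    intro c hc
    obtain ⟨b, -, hc⟩ := Multiset.mem_sum.1 hc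
    exact .head ⟨b, rfl⟩ (ih b c hc)

theorem exists_node_of_mem_leaves {t : T.Node} (α : T.Subcircuit t) :
    ∀ l ∈ α.leaves, ∃ t', Relation.ReflTransGen T.Edge t t' ∧ T.kind t' = .leaf l := by
  induction α with
  | @leaf t l h =>
    intro l' hl
    obtain rfl : l' = l := by simpa [leaves] using hl
    exact ⟨t, .refl, h⟩
  | sum h b α ih =>
    intro l hl
    obtain ⟨t', ht, hk⟩ := ih l hl
    exact ⟨t', .head ⟨b, rfl⟩ ht, hk⟩
  | prod h α ih =>
    intro l hl
    obtain ⟨b, -, hl⟩ := Multiset.mem_sum.1 hl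
    obtain ⟨t', ht, hk⟩ := ih b l hl
    exact ⟨t', .head ⟨b, rfl⟩ ht, hk⟩

/-- Bookkeeping for `exchange` at a product node, where one child's subcircuit is altered and the
others are kept. -/
theorem sum_update {B : Type*} [Fintype B] [DecidableEq B] {A : B → Type*} {M : Type*}
    [AddCommMonoid M] (F : ∀ b, A b → M) (α : ∀ b, A b) (b : B) (β : A b) :
    ∑ b', F b' (Function.update α b β b') = F b β + ∑ b' ∈ Finset.univ.erase b, F b' (α b') := by
  rw [← Finset.add_sum_erase _ _ (Finset.mem_univ b), Function.update_self]
  congr 1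
  refine Finset.sum_congr rfl fun b' hb' => ?_
  rw [Function.update_of_ne (Finset.ne_of_mem_erase hb')]

/-- At a sum node `s` chosen by the complete subcircuit `α`, the part `γ` of `α` below `s` can be
exchanged for any other complete subcircuit below `s`. -/
theorem exchange {r : T.Node} (α : T.Subcircuit r) : ∀ c ∈ α.choices,
    ∃ γ : T.Subcircuit c.1.1, ∀ γ' : T.Subcircuit c.1.1, ∃ β : T.Subcircuit r,
      β.leaves + γ.leaves = α.leaves + γ'.leaves ∧
      β.choices + γ.choices = α.choices + γ'.choices ∧ γ'.leaves ≤ β.leaves := by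
  classical
  induction α with
  | leaf h => simp [choices]
  | @sum t h b α ih =>
    intro c hc
    rcases Multiset.mem_cons.1 hc with rfl | hc
    -- The chosen node is the top itself: the whole subcircuit is exchanged.
    · exact ⟨.sum h b α, fun γ' => ⟨γ', add_comm _ _, add_comm _ _, le_rfl⟩⟩
    · obtain ⟨γ, hγ⟩ := ih c hc
      refine ⟨γ, fun γ' => ?_⟩
      obtain ⟨β, h1, h2, h3⟩ := hγ γ'
      refine ⟨.sum h b β, h1, ?_, h3⟩
      simp only [choices, Multiset.cons_add, h2]
  | @prod t h α ih =>
    intro c hc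
    obtain ⟨b, -, hc⟩ := Multiset.mem_sum.1 hc
    obtain ⟨γ, hγ⟩ := ih b c hc
    refine ⟨γ, fun γ' => ?_⟩
    obtain ⟨β, h1, h2, h3⟩ := hγ γ'
    refine ⟨.prod h (Function.update α b β), ?_, ?_, ?_⟩
    · simp only [leaves]
      rw [sum_update (A := fun b => T.Subcircuit (T.child t b)) (fun _ β => β.leaves), ← Finset.add_sum_erase _ _ (Finset.mem_univ b),
        add_right_comm, h1, add_right_comm]
    · simp only [choices]
      rw [sum_update (A := fun b => T.Subcircuit (T.child t b)) (fun _ β => β.choices), ← Finset.add_sum_erase _ _ (Finset.mem_univ b),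
        add_right_comm, h2, add_right_comm]
    · simp only [leaves]
      rw [sum_update (A := fun b => T.Subcircuit (T.child t b)) (fun _ β => β.leaves)]
      exact h3.trans (Multiset.le_add_right _ _)

end Subcircuit

/-- For every choice of branches there is a complete subcircuit that follows it. -/
theorem exists_follows (pick : ∀ s : T.SumNode, T.Branch s) (t : T.Node) :
    ∃ α : T.Subcircuit t, ∀ c ∈ α.choices, c.2 = pick c.1 := by
  induction t using T.acyclic.induction with
  | _ t ih =>
    choose α hα using fun b => ih _ ⟨b, rfl⟩
    cases hk : T.kind t with
    | leaf l => exact ⟨.leaf hk, by simp [Subcircuit.choices]⟩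
    | sum =>
      refine ⟨.sum hk _ (α (pick ⟨t, hk⟩)), fun c hc => ?_⟩
      rcases Multiset.mem_cons.1 hc with rfl | hc
      · rfl
      · exact hα _ c hc
    | prod =>
      refine ⟨.prod hk α, fun c hc => ?_⟩
      obtain ⟨b, -, hc⟩ := Multiset.mem_sum.1 hc
      exact hα b c hc

/-- The only freedom in a complete subcircuit is the branch taken at each visited sum node. -/
theorem Subcircuit.eq_of_follows (pick : ∀ s : T.SumNode, T.Branch s) {t : T.Node}
    (α α' : T.Subcircuit t) (h : ∀ c ∈ α.choices, c.2 = pick c.1)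
    (h' : ∀ c ∈ α'.choices, c.2 = pick c.1) : α = α' := by
  induction α with
  | @leaf t l hk =>
    obtain ⟨_, hx⟩ := (leaf_bijective hk).2 α'
    exact hx
  | @sum t hk b α ih =>
    obtain ⟨⟨b', β⟩, rfl⟩ := (sum_bijective hk).2 α'
    have hb : b = pick ⟨t, hk⟩ := h ⟨⟨t, hk⟩, b⟩ (Multiset.mem_cons_self _ _)
    have hb' : b' = pick ⟨t, hk⟩ := h' ⟨⟨t, hk⟩, b'⟩ (Multiset.mem_cons_self _ _)
    subst hb hb'
    have := ih β (fun c hc => h c (Multiset.mem_cons_of_mem hc))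
      (fun c hc => h' c (Multiset.mem_cons_of_mem hc))
    rw [this]
  | @prod t hk α ih =>
    obtain ⟨β, rfl⟩ := (prod_bijective hk).2 α'
    have : α = β := by
      funext b
      exact ih b (β b) (fun c hc => h c (Multiset.mem_sum.2 ⟨b, Finset.mem_univ _, hc⟩))
        (fun c hc => h' c (Multiset.mem_sum.2 ⟨b, Finset.mem_univ _, hc⟩))
    rw [this]

/-- Every leaf reachable from `t` is visited by some complete subcircuit below `t`. -/
theorem exists_mem_leaves [∀ s : T.SumNode, Nonempty (T.Branch s)] {t t' : T.Node} {l : L}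
    (h : Relation.ReflTransGen T.Edge t t') (hl : T.kind t' = .leaf l) :
    ∃ α : T.Subcircuit t, l ∈ α.leaves := by
  classical
  induction h using Relation.ReflTransGen.head_induction_on with
  | refl => exact ⟨.leaf hl, by simp [Subcircuit.leaves]⟩
  | @head s u hsu _ ih =>
    obtain ⟨b, rfl⟩ := hsu
    obtain ⟨α, hα⟩ := ih
    cases hk : T.kind s with
    | leaf l' => exact ((T.leaf_isEmpty s l' hk).false b).elim
    | sum => exact ⟨.sum hk b α, hα⟩
    | prod =>
      -- The siblings only need some complete subcircuit; nonempty branch types provide one.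
      choose β _ using fun b => exists_follows (T := T) (fun s => Classical.arbitrary _)
        (T.child s b)
      refine ⟨.prod hk (Function.update β b α), Multiset.mem_sum.2 ⟨b, Finset.mem_univ _, ?_⟩⟩
      rwa [Function.update_self]

/-! ### Bottom-up evaluation and optimization of circuits -/

noncomputable section

/-- The value at the node `t`: the sum over all complete subcircuits below `t` of the product of
the values of their leaves and of the weights of their chosen branches. -/
def value (f : L → ℝ) (W : ∀ s : T.SumNode, T.Branch s → ℝ) (t : T.Node) : ℝ :=
  ∑ α : T.Subcircuit t, (α.leaves.map f).prod * (α.choices.map (fun c => W c.1 c.2)).prod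

variable {f : L → ℝ} {W : ∀ s : T.SumNode, T.Branch s → ℝ} {t : T.Node}

theorem value_leaf {l : L} (h : T.kind t = .leaf l) : value f W t = f l := by
  rw [value, ← (Subcircuit.leaf_bijective h).sum_comp]
  simp [Subcircuit.leaves, Subcircuit.choices]

theorem value_sum (h : T.kind t = .sum) :
    value f W t = ∑ b, W ⟨t, h⟩ b * value f W (T.child t b) := by
  rw [value, ← (Subcircuit.sum_bijective h).sum_comp, Fintype.sum_sigma]
  refine Finset.sum_congr rfl fun b _ => ?_
  rw [value, Finset.mul_sum]
  refine Finset.sum_congr rfl fun α _ => ?_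
  simp only [Subcircuit.leaves, Subcircuit.choices, Multiset.map_cons, Multiset.prod_cons]
  ring

theorem prod_map_sum {A B : Type*} [Fintype B] (m : B → Multiset A) (g : A → ℝ) :
    ((∑ b, m b).map g).prod = ∏ b, ((m b).map g).prod := by
  have := map_sum (Multiset.mapAddMonoidHom g) m Finset.univ
  simp only [Multiset.coe_mapAddMonoidHom] at this
  rw [this, Multiset.prod_sum]

theorem value_prod (h : T.kind t = .prod) :
    value f W t = ∏ b, value f W (T.child t b) := by
  classical
  rw [value, ← (Subcircuit.prod_bijective h).sum_comp]
  simp only [value, Finset.prod_univ_sum, Fintype.piFinset_univ]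
  refine Finset.sum_congr rfl fun α _ => ?_
  simp only [Subcircuit.leaves, Subcircuit.choices, prod_map_sum, Finset.prod_mul_distrib]

theorem value_nonneg (hf : ∀ l, 0 ≤ f l) (hW : ∀ s b, 0 ≤ W s b) (t : T.Node) :
    0 ≤ value f W t := by
  refine Finset.sum_nonneg fun α _ => mul_nonneg ?_ ?_
  · refine Multiset.prod_nonneg fun x hx => ?_
    obtain ⟨l, -, rfl⟩ := Multiset.mem_map.1 hx
    exact hf l
  · refine Multiset.prod_nonneg fun x hx => ?_
    obtain ⟨c, -, rfl⟩ := Multiset.mem_map.1 hx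
    exact hW _ _

/-- If replacing the weights `W'` by `W` at a single sum node never increases its value, then
replacing them everywhere does not either. -/
theorem value_le_value {W' : ∀ s : T.SumNode, T.Branch s → ℝ} (hf : ∀ l, 0 ≤ f l)
    (hW : ∀ s b, 0 ≤ W s b)
    (h : ∀ s, ∑ b, W s b * value f W' (T.child s b) ≤ ∑ b, W' s b * value f W' (T.child s b))
    (t : T.Node) : value f W t ≤ value f W' t := by
  induction t using T.acyclic.induction with
  | _ t ih =>
    cases hk : T.kind t with
    | leaf l => rw [value_leaf hk, value_leaf hk]
    | sum =>
      rw [value_sum hk, value_sum hk]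
      exact (Finset.sum_le_sum fun b _ => mul_le_mul_of_nonneg_left (ih _ ⟨b, rfl⟩)
        (hW _ _)).trans (h ⟨t, hk⟩)
    | prod =>
      rw [value_prod hk, value_prod hk]
      exact Finset.prod_le_prod (fun b _ => value_nonneg hf hW _) fun b _ => ih _ ⟨b, rfl⟩

/-- The value at `t` depends only on the weights of the sum nodes reachable from `t`. -/
theorem value_congr {W' : ∀ s : T.SumNode, T.Branch s → ℝ}
    (h : ∀ s : T.SumNode, Relation.ReflTransGen T.Edge t s.1 → W s = W' s) :
    value f W t = value f W' t := by
  refine Finset.sum_congr rfl fun α _ => ?_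
  congr 2
  refine Multiset.map_congr rfl fun c hc => ?_
  rw [h c.1 (α.reachable_of_mem_choices c hc)]

/-- The value at `t` if the weights of each sum node are chosen from `F`, from the bottom up, so as
to maximize its value. -/
def optimalValue (f : L → ℝ) (F : ∀ s : T.SumNode, Set (T.Branch s → ℝ)) : T.Node → ℝ :=
  open Classical in
  T.acyclic.fix fun t ih =>
    if h : T.kind t = .sum then
      sSup ((fun w : T.Branch t → ℝ => ∑ b, w b * ih (T.child t b) ⟨b, rfl⟩) '' F ⟨t, h⟩)
    else
      match T.kind t with
      | .leaf l => f l
      | _ => ∏ b, ih (T.child t b) ⟨b, rfl⟩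

/-- Dynamic programming: the values of the children do not involve the weights of the node itself,
so one choice of weights is optimal at all nodes simultaneously. Finiteness of `F s` ensures that
each local maximum is attained. -/
theorem exists_optimal_weights (f : L → ℝ) (F : ∀ s : T.SumNode, Set (T.Branch s → ℝ))
    (hfin : ∀ s, (F s).Finite) (hne : ∀ s, (F s).Nonempty) :
    ∃ W : ∀ s : T.SumNode, T.Branch s → ℝ, (∀ s, W s ∈ F s) ∧ ∀ s, ∀ w ∈ F s,
      ∑ b, w b * value f W (T.child s b) ≤ ∑ b, W s b * value f W (T.child s b) := by
  -- The maximization is against `optimalValue`, which is defined without `W`; that it is the value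
  -- under `W` is proved afterwards.
  choose W hW hmax using fun s : T.SumNode => Set.exists_max_image (F s)
    (fun w => ∑ b, w b * optimalValue f F (T.child s b)) (hfin s) (hne s)
  have key : ∀ t, value f W t = optimalValue f F t := by
    intro t
    induction t using T.acyclic.induction with
    | _ t ih =>
      rw [optimalValue, WellFounded.fix_eq]
      split_ifs with h
      · rw [value_sum h]
        have ih' : ∀ b, value f W (T.child t b) = optimalValue f F (T.child t b) :=
          fun b => ih _ ⟨b, rfl⟩
        simp only [ih']
        have hgreatest : IsGreatest ((fun w : T.Branch t → ℝ =>
            ∑ b, w b * optimalValue f F (T.child t b)) '' F ⟨t, h⟩)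
            (∑ b, W ⟨t, h⟩ b * optimalValue f F (T.child t b)) := by
          refine ⟨⟨W ⟨t, h⟩, hW _, rfl⟩, ?_⟩
          rintro _ ⟨w, hw, rfl⟩
          exact hmax ⟨t, h⟩ w hw
        exact hgreatest.csSup_eq.symm
      · split
        · next l hl => exact value_leaf hl
        · next hl =>
          have hk : T.kind t = .prod := by
            cases hk : T.kind t with
            | leaf l => exact (hl l hk).elim
            | sum => exact (h hk).elim
            | prod => rfl
          rw [value_prod hk]
          exact Finset.prod_congr rfl fun b _ => ih _ ⟨b, rfl⟩
  refine ⟨W, hW, fun s w hw => ?_⟩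
  simp only [key]
  exact hmax s w hw

end

end Circuit

end CredalNet

/-! ### Complete subcircuits and terms of the network polynomial -/

namespace CredalNet

/-- If two sums of monomials agree, then every monomial of the first occurs in the second. -/
theorem exists_eq_of_sum_monomials_eq {L A B : Type*} [Fintype A] [Fintype B]
    {m : A → Multiset L} {m' : B → Multiset L}
    (h : ∑ a, ((m a).map (MvPolynomial.X (R := ℝ))).prod =
      ∑ b, ((m' b).map (MvPolynomial.X (R := ℝ))).prod) (a : A) : ∃ b, m' b = m a := by
  classical
  have key : ∀ s : Multiset L, (s.map (MvPolynomial.X (R := ℝ))).prod =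
      MvPolynomial.monomial (Multiset.toFinsupp s) 1 := by
    intro s
    induction s using Multiset.induction_on with
    | empty => simp
    | cons l s ih =>
      rw [Multiset.map_cons, Multiset.prod_cons, ih, ← Multiset.singleton_add, map_add,
        Multiset.toFinsupp_singleton, MvPolynomial.X, MvPolynomial.monomial_mul, one_mul]
  by_contra! hne
  have h1 := congrArg (MvPolynomial.coeff (Multiset.toFinsupp (m a))) h
  simp only [key, MvPolynomial.coeff_sum, MvPolynomial.coeff_monomial,
    EmbeddingLike.apply_eq_iff_eq, hne, if_false, Finset.sum_const_zero] at h1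
  -- All coefficients are nonnegative, so the monomial of `a` cannot cancel.
  have h2 : (1 : ℝ) ≤ ∑ a', if m a' = m a then (1 : ℝ) else 0 := by
    refine le_trans ?_ (Finset.single_le_sum (f := fun a' => if m a' = m a then (1 : ℝ) else 0)
      (fun _ _ => by positivity) (Finset.mem_univ a))
    simp
  linarith

variable {ι : Type*} {Ω : ι → Type*}

/-- The term of the instantiation `v` in the network polynomial. -/
def BNGraph.networkTerm [Fintype ι] (G : BNGraph ι) (v : ∀ i, Ω i) : Multiset (ACLabel G Ω) :=
  ∑ i, {ACLabel.par i (v i) (fun j => v j), ACLabel.ind i (v i)}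

namespace BNGraph

variable [Fintype ι] {G : BNGraph ι} {v : ∀ i, Ω i}

theorem ind_mem_networkTerm {i : ι} {x : Ω i} :
    ACLabel.ind i x ∈ G.networkTerm v ↔ v i = x := by
  simp only [networkTerm, Multiset.mem_sum, Finset.mem_univ, true_and, Multiset.insert_eq_cons,
    Multiset.mem_cons, Multiset.mem_singleton, reduceCtorEq, false_or]
  constructor
  · rintro ⟨j, h⟩
    cases h
    rfl
  · rintro rfl
    exact ⟨i, rfl⟩

theorem par_mem_networkTerm {i : ι} {x : Ω i} {u : G.ParentInst Ω i} :
    ACLabel.par i x u ∈ G.networkTerm v ↔ v i = x ∧ (fun j : G.pa i => v j) = u := by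
  simp only [networkTerm, Multiset.mem_sum, Finset.mem_univ, true_and, Multiset.insert_eq_cons,
    Multiset.mem_cons, Multiset.mem_singleton, reduceCtorEq, or_false]
  constructor
  · rintro ⟨j, h⟩
    cases h
    exact ⟨rfl, rfl⟩
  · rintro ⟨rfl, rfl⟩
    exact ⟨i, rfl⟩

end BNGraph

namespace AC

variable {G : BNGraph ι} {T : AC G Ω}

/-- The number of indicators of the variable `i` among the labels `m`. -/
noncomputable def indCount (i : ι) (m : Multiset (ACLabel G Ω)) : ℕ :=
  open Classical in m.countP (fun l => ∃ x : Ω i, l = .ind i x)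

theorem indCount_sum {B : Type*} [Fintype B] (i : ι) (m : B → Multiset (ACLabel G Ω)) :
    indCount i (∑ b, m b) = ∑ b, indCount i (m b) := by
  classical
  exact map_sum (Multiset.countPAddMonoidHom (fun l : ACLabel G Ω => ∃ x : Ω i, l = .ind i x)) _ _

theorem indCount_pos {i : ι} {x : Ω i} {m : Multiset (ACLabel G Ω)} (h : .ind i x ∈ m) :
    0 < indCount i m := by
  classical
  rw [indCount]
  exact Multiset.countP_pos.2 ⟨_, h, x, rfl⟩

theorem indCount_networkTerm [Fintype ι] (i : ι) (v : ∀ i, Ω i) :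
    indCount i (G.networkTerm v) = 1 := by
  classical
  rw [BNGraph.networkTerm, indCount_sum, Finset.sum_eq_single i]
  · rw [indCount, Multiset.insert_eq_cons, Multiset.countP_cons_of_neg _ (by simp),
      ← Multiset.cons_zero, Multiset.countP_cons_of_pos _ ⟨_, rfl⟩, Multiset.countP_zero]
  · intro j _ hj
    simp only [indCount, Multiset.countP_eq_zero]
    rintro l hl ⟨x, rfl⟩
    simp only [Multiset.insert_eq_cons, Multiset.mem_cons, reduceCtorEq, false_or,
      Multiset.mem_singleton, ACLabel.ind.injEq] at hl
    exact hj hl.1.symm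
  · simp

namespace Splitting

variable (sp : Splitting T)

/-- The branch of a sum node that the instantiation `v` chooses. -/
def pick (v : ∀ i, Ω i) (s : T.SumNode) : T.Branch s :=
  (sp.val s).symm (v (sp.var s))

/-- The complete subcircuit below `t` that the instantiation `v` chooses. -/
noncomputable def chosen (v : ∀ i, Ω i) (t : T.Node) : T.Subcircuit t :=
  (Circuit.exists_follows (sp.pick v) t).choose

/-- Existence and uniqueness of the subcircuit that follows given picks; this is the only way in
which `chosen` is used. -/
theorem eq_chosen_iff {v : ∀ i, Ω i} {t : T.Node} {α : T.Subcircuit t} :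
    α = sp.chosen v t ↔ ∀ c ∈ α.choices, sp.val c.1 c.2 = v (sp.var c.1) := by
  have h := (Circuit.exists_follows (sp.pick v) t).choose_spec
  simp only [← Equiv.eq_symm_apply]
  exact ⟨by rintro rfl; exact h, fun h' => Circuit.Subcircuit.eq_of_follows _ _ _ h' h⟩

theorem val_of_mem_chosen {v : ∀ i, Ω i} {t : T.Node} :
    ∀ c ∈ (sp.chosen v t).choices, sp.val c.1 c.2 = v (sp.var c.1) :=
  (sp.eq_chosen_iff).1 rfl

theorem ind_mem_leaves {t : T.Node} (α : T.Subcircuit t) :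
    ∀ c ∈ α.choices, ACLabel.ind (sp.var c.1) (sp.val c.1 c.2) ∈ α.leaves := by
  induction α with
  | leaf h => simp [Circuit.Subcircuit.choices]
  | @sum t h b α ih =>
    intro c hc
    rcases Multiset.mem_cons.1 hc with rfl | hc
    · exact sp.contains ⟨t, h⟩ b α
    · exact ih c hc
  | prod h α ih =>
    intro c hc
    obtain ⟨b, -, hc⟩ := Multiset.mem_sum.1 hc
    exact Multiset.mem_sum.2 ⟨b, Finset.mem_univ _, ih b c hc⟩

/-- The sum node `s` is visited by the complete subcircuit that `v` chooses. -/
def Visits (v : ∀ i, Ω i) (s : T.SumNode) : Prop :=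
  ∃ b, ⟨s, b⟩ ∈ (sp.chosen v T.root).choices

end Splitting

namespace Computes

variable [Fintype ι] [DecidableEq ι] [∀ i, Fintype (Ω i)] {sp : Splitting T} {n : ℕ}
  {σ : ι ≃ Fin n}

theorem sum_monomials_eq (hT : Computes T sp σ) :
    ∑ α : T.Subcircuit T.root, (α.leaves.map (MvPolynomial.X (R := ℝ))).prod =
      ∑ v : ∀ i, Ω i, ((G.networkTerm v).map MvPolynomial.X).prod := by
  refine hT.poly_eq.trans (Finset.sum_congr rfl fun v _ => ?_)
  rw [BNGraph.networkTerm]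
  have := map_sum (Multiset.mapAddMonoidHom (MvPolynomial.X (R := ℝ)))
    (fun i => ({ACLabel.par i (v i) (fun j => v j), ACLabel.ind i (v i)} :
      Multiset (ACLabel G Ω))) Finset.univ
  simp only [Multiset.coe_mapAddMonoidHom] at this
  rw [this, Multiset.prod_sum]
  simp

/-- Some subcircuit has the term of `v` as its monomial. Each of its choices puts the corresponding
indicator among its leaves, so every choice agrees with `v`. -/
theorem leaves_chosen (hT : Computes T sp σ) (v : ∀ i, Ω i) :
    (sp.chosen v T.root).leaves = G.networkTerm v := by
  obtain ⟨α, hα⟩ := exists_eq_of_sum_monomials_eq hT.sum_monomials_eq.symm v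
  rw [← hα]
  congr 1
  refine (sp.eq_chosen_iff.2 fun c hc => ?_).symm
  have := sp.ind_mem_leaves α c hc
  rw [hα, BNGraph.ind_mem_networkTerm] at this
  exact this.symm

theorem exists_eq_chosen (hT : Computes T sp σ) (α : T.Subcircuit T.root) :
    ∃ v, α = sp.chosen v T.root := by
  obtain ⟨v, hv⟩ := exists_eq_of_sum_monomials_eq hT.sum_monomials_eq α
  refine ⟨v, sp.eq_chosen_iff.2 fun c hc => ?_⟩
  have := sp.ind_mem_leaves α c hc
  rw [← hv, BNGraph.ind_mem_networkTerm] at this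
  exact this.symm

theorem chosen_bijective (hT : Computes T sp σ) :
    Function.Bijective (fun v => sp.chosen v T.root) := by
  refine ⟨fun v v' h => funext fun i => ?_, fun α => ?_⟩
  · have h1 : ACLabel.ind i (v i) ∈ G.networkTerm v := BNGraph.ind_mem_networkTerm.2 rfl
    rw [← hT.leaves_chosen, show sp.chosen v T.root = _ from h, hT.leaves_chosen,
      BNGraph.ind_mem_networkTerm] at h1
    exact h1.symm
  · obtain ⟨v, hv⟩ := hT.exists_eq_chosen α
    exact ⟨v, hv.symm⟩

/-- Every variable with at least two values is split on. -/
theorem exists_choice (hT : Computes T sp σ) (v : ∀ i, Ω i) (i : ι) [Nontrivial (Ω i)] :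
    ∃ c ∈ (sp.chosen v T.root).choices, sp.var c.1 = i := by
  by_contra! h
  -- If `i` were never split on, changing its value would not change the chosen subcircuit,
  -- contradicting injectivity.
  obtain ⟨x, hx⟩ := exists_ne (v i)
  have heq : sp.chosen v T.root = sp.chosen (Function.update v i x) T.root := by
    refine sp.eq_chosen_iff.2 fun c hc => ?_
    rw [Function.update_of_ne (h c hc)]
    exact sp.val_of_mem_chosen c hc
  have := congrFun (hT.chosen_bijective.1 heq) i
  rw [Function.update_self] at this
  exact hx this.symm

theorem var_lt_of_mem_choices (hT : Computes T sp σ) (s : T.SumNode) (b : T.Branch s)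
    (α : T.Subcircuit (T.child s b)) : ∀ c ∈ α.choices, σ (sp.var s) < σ (sp.var c.1) :=
  fun c hc => hT.ordered s c.1 (.head' ⟨b, rfl⟩ (α.reachable_of_mem_choices c hc))

theorem var_le_of_mem_choices (hT : Computes T sp σ) (s : T.SumNode)
    (α : T.Subcircuit s.1) : ∀ c ∈ α.choices, σ (sp.var s) ≤ σ (sp.var c.1) := by
  intro c hc
  rcases Relation.reflTransGen_iff_eq_or_transGen.1 (α.reachable_of_mem_choices c hc) with h | h
  · rw [Subtype.ext h]
  · exact (hT.ordered s c.1 h).le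

/-- Two splits on the same variable cannot be nested, by the ordering condition, so they lie below
different children of a product node, and each contributes its own indicator. -/
theorem count_var_le_indCount (hT : Computes T sp σ) (i : ι) {t : T.Node}
    (α : T.Subcircuit t) :
    (α.choices.map (fun c => sp.var c.1)).count i ≤ indCount i α.leaves := by
  induction α with
  | leaf h => simp [Circuit.Subcircuit.choices]
  | @sum t h b α ih =>
    by_cases hi : sp.var ⟨t, h⟩ = i
    · have h0 : (α.choices.map (fun c => sp.var c.1)).count i = 0 := by
        refine Multiset.count_eq_zero.2 fun hmem => ?_
        obtain ⟨c, hc, hci⟩ := Multiset.mem_map.1 hmem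
        have := hT.var_lt_of_mem_choices ⟨t, h⟩ b α c hc
        rw [hi, hci] at this
        exact lt_irrefl _ this
      simp only [Circuit.Subcircuit.choices, Multiset.map_cons, hi, Multiset.count_cons_self, h0]
      refine indCount_pos (x := hi ▸ sp.val ⟨t, h⟩ b) ?_
      subst hi
      exact sp.contains ⟨t, h⟩ b α
    · simp only [Circuit.Subcircuit.choices, Multiset.map_cons]
      rw [Multiset.count_cons_of_ne (Ne.symm hi)]
      exact ih
  | prod h α ih =>
    have := map_sum (Multiset.mapAddMonoidHom
      (fun c : (s : T.SumNode) × T.Branch s => sp.var c.1)) (fun b => (α b).choices) Finset.univ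
    simp only [Multiset.coe_mapAddMonoidHom] at this
    simp only [Circuit.Subcircuit.choices, Circuit.Subcircuit.leaves]
    rw [this, indCount_sum, Multiset.count_sum']
    exact Finset.sum_le_sum fun b _ => ih b

/-- Each term of the network polynomial contains exactly one indicator per variable. -/
theorem nodup_choices (hT : Computes T sp σ) (v : ∀ i, Ω i) :
    ((sp.chosen v T.root).choices.map (fun c => sp.var c.1)).Nodup := by
  refine Multiset.nodup_iff_count_le_one.2 fun i => ?_
  rw [← indCount_networkTerm (G := G) i v, ← hT.leaves_chosen]
  exact hT.count_var_le_indCount i _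

theorem choice_unique (hT : Computes T sp σ) {v : ∀ i, Ω i}
    {c c' : (s : T.SumNode) × T.Branch s} (hc : c ∈ (sp.chosen v T.root).choices)
    (hc' : c' ∈ (sp.chosen v T.root).choices) (h : sp.var c.1 = sp.var c'.1) : c = c' :=
  Multiset.inj_on_of_nodup_map (hT.nodup_choices v) c hc c' hc' h

/-! ### Visited sum nodes and the parent values below them -/

/-- The node that splits on `i` depends only on the values of the variables before `i`. -/
theorem exists_choice_of_agree (hT : Computes T sp σ) {v v' : ∀ i, Ω i} {i : ι}
    (hv : ∀ j, σ j < σ i → v j = v' j) {t : T.Node} (α α' : T.Subcircuit t)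
    (hα : ∀ c ∈ α.choices, sp.val c.1 c.2 = v (sp.var c.1))
    (hα' : ∀ c ∈ α'.choices, sp.val c.1 c.2 = v' (sp.var c.1)) :
    ∀ c ∈ α.choices, sp.var c.1 = i → ∃ b, ⟨c.1, b⟩ ∈ α'.choices := by
  induction α with
  | leaf h => simp [Circuit.Subcircuit.choices]
  | @sum t h b α ih =>
    intro c hc hci
    obtain ⟨⟨b', α'⟩, rfl⟩ := (Circuit.Subcircuit.sum_bijective h).2 α'
    rcases Multiset.mem_cons.1 hc with rfl | hc
    · exact ⟨b', Multiset.mem_cons_self _ _⟩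
    · have hlt := hT.var_lt_of_mem_choices ⟨t, h⟩ b α c hc
      rw [hci] at hlt
      -- Above the split on `i` only earlier variables are split on, and there the two
      -- instantiations agree, so both subcircuits take the same branch.
      have hb : b = b' := by
        refine (sp.val ⟨t, h⟩).injective ?_
        rw [hα ⟨⟨t, h⟩, b⟩ (Multiset.mem_cons_self _ _), hv _ hlt,
          hα' ⟨⟨t, h⟩, b'⟩ (Multiset.mem_cons_self _ _)]
      subst hb
      obtain ⟨b', hb'⟩ := ih α' (fun c hc => hα c (Multiset.mem_cons_of_mem hc))
        (fun c hc => hα' c (Multiset.mem_cons_of_mem hc)) c hc hci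
      exact ⟨b', Multiset.mem_cons_of_mem hb'⟩
  | @prod t h α ih =>
    intro c hc hci
    obtain ⟨α', rfl⟩ := (Circuit.Subcircuit.prod_bijective h).2 α'
    obtain ⟨b, -, hc⟩ := Multiset.mem_sum.1 hc
    obtain ⟨b', hb'⟩ := ih b (α' b)
      (fun c hc => hα c (Multiset.mem_sum.2 ⟨b, Finset.mem_univ _, hc⟩))
      (fun c hc => hα' c (Multiset.mem_sum.2 ⟨b, Finset.mem_univ _, hc⟩)) c hc hci
    exact ⟨b', Multiset.mem_sum.2 ⟨b, Finset.mem_univ _, hb'⟩⟩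

theorem visits_of_agree (hT : Computes T sp σ) {v v' : ∀ i, Ω i} {s : T.SumNode}
    (hv : ∀ j, σ j < σ (sp.var s) → v j = v' j) (hs : sp.Visits v s) : sp.Visits v' s := by
  obtain ⟨b, hb⟩ := hs
  exact hT.exists_choice_of_agree hv _ _ sp.val_of_mem_chosen sp.val_of_mem_chosen _ hb rfl

/-- Below a visited sum node, all parameters agree with the visiting instantiation on the
variables before the split variable. -/
theorem eq_of_mem_possibleValues (hT : Computes T sp σ) {v : ∀ i, Ω i} {s : T.SumNode}
    [∀ i, Nonempty (Ω i)] (hs : sp.Visits v s) {j : ι} (hj : σ j < σ (sp.var s)) {w : Ω j}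
    (hw : w ∈ possibleValues T s.1 j) : w = v j := by
  rcases subsingleton_or_nontrivial (Ω j) with _ | _
  · exact Subsingleton.elim _ _
  obtain ⟨t', ht', i, x, u, hji, hk, rfl⟩ := hw
  have : ∀ s : T.SumNode, Nonempty (T.Branch s) := fun s => ⟨sp.pick v s⟩
  -- The parameter is put into a full subcircuit by exchanging below `s`; the result belongs to some
  -- `v'` with `v' j = w`. The split on `j` happens outside the part below `s`, hence survives the
  -- exchange and forces `v' j = v j`.
  obtain ⟨γ', hγ'⟩ := Circuit.exists_mem_leaves ht' hk
  obtain ⟨b, hb⟩ := hs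
  obtain ⟨γ, hγ⟩ := (sp.chosen v T.root).exchange _ hb
  obtain ⟨β, -, h2, h3⟩ := hγ γ'
  obtain ⟨v', rfl⟩ := hT.exists_eq_chosen β
  have hpar := Multiset.mem_of_le h3 hγ'
  rw [hT.leaves_chosen, BNGraph.par_mem_networkTerm] at hpar
  obtain ⟨c, hc, rfl⟩ := hT.exists_choice v j
  have hc' : c ∈ (sp.chosen v' T.root).choices + γ.choices := by
    rw [h2]
    exact Multiset.mem_add.2 (.inl hc)
  rcases Multiset.mem_add.1 hc' with hc' | hc'
  · rw [← sp.val_of_mem_chosen c hc, sp.val_of_mem_chosen c hc', ← hpar.2]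
  · exact absurd (hT.var_le_of_mem_choices s γ c hc') (not_le.2 hj)

/-- Below a visited sum node there is the parameter of the visiting instantiation for the split
variable. -/
theorem mem_possibleValues (hT : Computes T sp σ) {v : ∀ i, Ω i} {s : T.SumNode}
    [∀ i, Nonempty (Ω i)] (hs : sp.Visits v s) [Nontrivial (Ω (sp.var s))] {j : ι}
    (hj : j ∈ G.pa (sp.var s)) : v j ∈ possibleValues T s.1 j := by
  obtain ⟨b, hb⟩ := hs
  obtain ⟨γ, hγ⟩ := (sp.chosen v T.root).exchange _ hb
  -- Redirecting `s` to the branch of another value `x` yields an instantiation whose term lacks the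
  -- parameter of `v` for the split variable. The exchange removed it, so it lay below `s`.
  obtain ⟨x, hx⟩ := exists_ne (v (sp.var s))
  have hpar : ACLabel.par (sp.var s) (v (sp.var s)) (fun j => v j) ∈ γ.leaves := by
    let γ' : T.Subcircuit s.1 :=
      .sum s.2 ((sp.val s).symm x) (sp.chosen v _)
    have hγ' : ACLabel.ind (sp.var s) x ∈ γ'.leaves := by
      have := sp.contains s ((sp.val s).symm x) (sp.chosen v _)
      rwa [Equiv.apply_symm_apply] at this
    obtain ⟨β, h1, -, h3⟩ := hγ γ'
    obtain ⟨v', rfl⟩ := hT.exists_eq_chosen β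
    have h4 := Multiset.mem_of_le h3 hγ'
    rw [hT.leaves_chosen, BNGraph.ind_mem_networkTerm] at h4
    have h5 : ACLabel.par (sp.var s) (v (sp.var s)) (fun j => v j) ∈
        (sp.chosen v' T.root).leaves + γ.leaves := by
      rw [h1, hT.leaves_chosen]
      exact Multiset.mem_add.2 (.inl (BNGraph.par_mem_networkTerm.2 ⟨rfl, rfl⟩))
    refine (Multiset.mem_add.1 h5).resolve_left fun h6 => hx ?_
    rw [hT.leaves_chosen, BNGraph.par_mem_networkTerm] at h6
    rw [← h4, h6.1]
  obtain ⟨t', ht', hk⟩ := γ.exists_node_of_mem_leaves _ hpar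
  exact ⟨t', ht', _, _, _, hj, hk, rfl⟩

end Computes

end AC

/-- On a one-point domain there is only one probability vector, so the parent instantiation is
immaterial. -/
theorem CredalBN.credal_eq_of_subsingleton [∀ i, Fintype (Ω i)] (N : CredalBN ι Ω) (i : ι)
    [Subsingleton (Ω i)] (u u' : N.toBNGraph.ParentInst Ω i) : N.credal i u = N.credal i u' := by
  have key : ∀ u u' w, w ∈ N.credal i u → w ∈ N.credal i u' := by
    intro u u' w hw
    obtain ⟨w', hw'⟩ := N.credal_nonempty i u'
    have h1 := (N.credal_subset i u hw).2
    have h2 := (N.credal_subset i u' hw').2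
    have : w = w' := by
      funext x
      rw [Fintype.sum_subsingleton _ x] at h1 h2
      rw [h1, h2]
    rwa [this]
  exact Set.ext fun w => ⟨key u u' w, key u' u w⟩

/-- The credal set of a visited sum node is the one of its split variable for the parent values of
the visiting instantiation. -/
theorem AC.Computes.credal_parentValues [Fintype ι] [DecidableEq ι] [∀ i, Fintype (Ω i)]
    [∀ i, Nonempty (Ω i)] {N : CredalBN ι Ω} {T : AC N.toBNGraph Ω} {sp : Splitting T} {n : ℕ}
    {σ : ι ≃ Fin n} (hT : Computes T sp σ) (hσ : N.toBNGraph.IsTopologicalOrder σ)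
    {v : ∀ i, Ω i} {s : T.SumNode} (hs : sp.Visits v s) :
    N.credal (sp.var s) (parentValues T sp s) = N.credal (sp.var s) (fun j => v j) := by
  rcases subsingleton_or_nontrivial (Ω (sp.var s)) with _ | _
  · exact N.credal_eq_of_subsingleton _ _ _
  congr 1
  funext j
  -- The epsilon choice is legitimate because `v j` is a possible value, and it equals `v j` because
  -- every possible value does.
  exact hT.eq_of_mem_possibleValues hs (hσ _ j j.2)
    (Classical.epsilon_spec ⟨_, hT.mem_possibleValues hs j.2⟩)

end CredalNet

/-! ### The compiled network evaluated on the original circuit -/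

namespace CredalNet

variable {ι : Type*} {Ω : ι → Type*}

noncomputable section

namespace AC

variable {G : BNGraph ι} {T : AC G Ω}

/-- The values of the leaves of an arithmetic circuit if the indicators have the values `lam` and
all parameter nodes are replaced by `1`. -/
def leafValue (lam : ∀ i, Ω i → ℝ) : ACLabel G Ω → ℝ
  | .ind i x => lam i x
  | .par _ _ _ => 1

theorem leafValue_nonneg {lam : ∀ i, Ω i → ℝ} (h : ∀ i x, 0 ≤ lam i x) (l : ACLabel G Ω) :
    0 ≤ leafValue lam l := by
  cases l with
  | ind i x => exact h i x
  | par i x u => exact zero_le_one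

/-- Removing the parameter nodes amounts to replacing them by `1`. -/
theorem value_compile (sp : Splitting T) (hroot : ¬ IsParam T T.root) (lam : ∀ i, Ω i → ℝ)
    (W : ∀ s : T.SumNode, T.Branch s → ℝ) (t : T.Node) (ht : ¬ IsParam T t) :
    Circuit.value (T := compile T hroot) (fun l => lam l.1 l.2)
      (fun s b => W (origin T hroot s) b.1) ⟨t, ht⟩ = Circuit.value (leafValue lam) W t := by
  induction t using T.acyclic.induction with
  | _ t ih =>
    cases hk : T.kind t with
    | leaf l =>
      cases l with
      | ind i x =>
        have hk' : (compile T hroot).kind ⟨t, ht⟩ = .leaf ⟨i, x⟩ := by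
          simp [compile, hk, compileKind]
        rw [Circuit.value_leaf hk, Circuit.value_leaf hk']
        rfl
      | par i x u => exact (ht ⟨i, x, u, hk⟩).elim
    | sum =>
      have hk' : (compile T hroot).kind ⟨t, ht⟩ = .sum := by simp [compile, hk, compileKind]
      rw [Circuit.value_sum hk, Circuit.value_sum hk']
      let _ := (compile T hroot).branchFintype ⟨t, ht⟩
      let f : (compile T hroot).Branch ⟨t, ht⟩ ≃ T.Branch t :=
        Equiv.subtypeUnivEquiv (fun b => sp.child_not_isParam ⟨t, hk⟩ b)
      refine Fintype.sum_equiv f _ _ fun b => ?_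
      exact congrArg _ (ih _ ⟨b.1, rfl⟩ b.2)
    | prod =>
      have hk' : (compile T hroot).kind ⟨t, ht⟩ = .prod := by simp [compile, hk, compileKind]
      rw [Circuit.value_prod hk, Circuit.value_prod hk']
      let _ := (compile T hroot).branchFintype ⟨t, ht⟩
      let f : (compile T hroot).Branch ⟨t, ht⟩ → T.Branch t := Subtype.val
      -- The branches lost in compilation lead to parameter nodes, which contribute the factor `1`.
      refine Fintype.prod_of_injective f Subtype.val_injective _ _ (fun b hb => ?_) fun b => ih _ ⟨b.1, rfl⟩ b.2
      have : IsParam T (T.child t b) := by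
        by_contra h
        exact hb ⟨⟨b, h⟩, rfl⟩
      obtain ⟨i, x, u, h⟩ := this
      rw [Circuit.value_leaf h]
      rfl

/-- The weights of the sum nodes of the arithmetic circuit that belong to the weights of the
compiled credal network. -/
def credalWeights [∀ i, Fintype (Ω i)] [∀ i, Nonempty (Ω i)] (N : CredalBN ι Ω)
    (T : AC N.toBNGraph Ω) (sp : Splitting T) : Set (∀ s : T.SumNode, T.Branch s → ℝ) :=
  {W | ∀ s, ∃ θ ∈ N.credal (sp.var s) (parentValues T sp s), ∀ b, W s b = θ (sp.val s b)}

/-- Compilation loses neither sum nodes nor their branches, so weights transfer in both directions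
and the compiled circuit need not be considered again. -/
theorem marValues_compileCredal [∀ i, Fintype (Ω i)] [∀ i, Nonempty (Ω i)] (N : CredalBN ι Ω)
    (T : AC N.toBNGraph Ω) (sp : Splitting T) (hroot : ¬ IsParam T T.root) {E : Finset ι}
    (e : ∀ i : E, Ω i) :
    (compileCredal N T sp hroot).marValues e =
      (fun W => Circuit.value (leafValue (eventIndicators e)) W T.root) ''
        credalWeights N T sp := by
  have key := fun W => value_compile sp hroot (eventIndicators e) W T.root hroot
  ext y
  constructor
  · rintro ⟨W, hW, rfl⟩
    let hk : ∀ s : T.SumNode, ¬ IsParam T s.1 := fun s ⟨i, x, u, h⟩ => by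
      simp [s.2] at h
    let hs : ∀ s : T.SumNode, (compile T hroot).kind ⟨s.1, hk s⟩ = .sum := fun s => by
      simp [compile, s.2, compileKind]
    refine ⟨fun s b => W ⟨⟨s.1, hk s⟩, hs s⟩ ⟨b, sp.child_not_isParam s b⟩, fun s => ?_,
      (key _).symm⟩
    obtain ⟨θ, hθ, h⟩ := hW ⟨⟨s.1, hk s⟩, hs s⟩
    exact ⟨θ, hθ, fun b => h ⟨b, sp.child_not_isParam s b⟩⟩
  · rintro ⟨W, hW, rfl⟩
    refine ⟨fun s b => W (origin T hroot s) b.1, fun s => ?_, key W⟩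
    obtain ⟨θ, hθ, h⟩ := hW (origin T hroot s)
    exact ⟨θ, hθ, fun b => h b.1⟩

namespace Computes

variable [Fintype ι] [DecidableEq ι] [∀ i, Fintype (Ω i)] {sp : Splitting T} {n : ℕ}
  {σ : ι ≃ Fin n}

theorem value_root (hT : Computes T sp σ) (lam : ∀ i, Ω i → ℝ)
    (W : ∀ s : T.SumNode, T.Branch s → ℝ) :
    Circuit.value (leafValue lam) W T.root = ∑ v : ∀ i, Ω i, (∏ i, lam i (v i)) *
      ((sp.chosen v T.root).choices.map (fun c => W c.1 c.2)).prod := by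
  rw [Circuit.value, ← hT.chosen_bijective.sum_comp]
  refine Finset.sum_congr rfl fun v _ => ?_
  rw [hT.leaves_chosen, BNGraph.networkTerm, Circuit.prod_map_sum]
  simp [leafValue]

/-- The variables split on are pairwise distinct, and those missing have one-point domains. -/
theorem prod_choices (hT : Computes T sp σ) (v : ∀ i, Ω i) (F : ι → ℝ)
    (hF : ∀ i, Subsingleton (Ω i) → F i = 1) :
    ((sp.chosen v T.root).choices.map (fun c => F (sp.var c.1))).prod = ∏ i, F i := by
  have h : ∏ i ∈ ⟨_, hT.nodup_choices v⟩, F i = ∏ i, F i := by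
    refine Finset.prod_subset (Finset.subset_univ _) fun i _ hi => hF i ?_
    refine (subsingleton_or_nontrivial _).resolve_right fun _ => hi ?_
    obtain ⟨c, hc, hci⟩ := hT.exists_choice v i
    exact Multiset.mem_map.2 ⟨c, hc, hci⟩
  rw [← h, Finset.prod, Multiset.map_map]
  rfl

end Computes

end AC

theorem CredalBN.eq_one_of_subsingleton [∀ i, Fintype (Ω i)] (N : CredalBN ι Ω) {i : ι}
    [Subsingleton (Ω i)] {u : N.toBNGraph.ParentInst Ω i} {w : Ω i → ℝ} (hw : w ∈ N.credal i u)
    (x : Ω i) : w x = 1 := by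
  rw [← (N.credal_subset i u hw).2, Fintype.sum_subsingleton _ x]

/-- The expected value of `∏_i lam i (v i)` for the measure with the parameters `Θ`. -/
def BNGraph.expectation [Fintype ι] [DecidableEq ι] [∀ i, Fintype (Ω i)] (G : BNGraph ι)
    (Θ : G.Params Ω) (lam : ∀ i, Ω i → ℝ) : ℝ :=
  ∑ v : ∀ i, Ω i, (∏ i, lam i (v i)) * ∏ i, Θ i (fun j => v j) (v i)

theorem eventIndicators_nonneg {E : Finset ι} (e : ∀ i : E, Ω i) (i : ι) (x : Ω i) :
    0 ≤ eventIndicators e i x := by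
  rw [eventIndicators]
  split_ifs <;> norm_num

theorem BNGraph.prob_eq_expectation [Fintype ι] [DecidableEq ι] [∀ i, Fintype (Ω i)]
    (G : BNGraph ι) (Θ : G.Params Ω) {E : Finset ι} (e : ∀ i : E, Ω i) :
    G.prob Θ e = G.expectation Θ (eventIndicators e) := by
  refine Finset.sum_congr rfl fun v _ => ?_
  split_ifs with h
  · rw [Finset.prod_eq_one (f := fun i => eventIndicators e i (v i)), one_mul]
    intro i _
    rw [eventIndicators, if_pos fun hi => h ⟨i, hi⟩]
  · obtain ⟨i, hi⟩ := not_forall.1 h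
    rw [Finset.prod_eq_zero (Finset.mem_univ i.1), zero_mul]
    rw [eventIndicators, if_neg fun h' => hi (h' i.2)]

/-- Conditioning on the past: with `π` the restriction to the earlier variables, their weight `g`
factors out of each fibre, and the comparison is made for one past at a time. -/
theorem sum_mul_le_sum_mul_of_fiber {V P : Type*} [Fintype V] [DecidableEq P] (π : V → P)
    {g x y : V → ℝ} (hg : ∀ v, 0 ≤ g v) (hπ : ∀ v v', π v = π v' → g v = g v')
    (h : ∀ v₀, ∑ v with π v = π v₀, x v ≤ ∑ v with π v = π v₀, y v) :
    ∑ v, g v * x v ≤ ∑ v, g v * y v := by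
  have hmem : ∀ v ∈ (Finset.univ : Finset V), π v ∈ Finset.univ.image π :=
    fun v _ => Finset.mem_image_of_mem _ (Finset.mem_univ v)
  rw [← Finset.sum_fiberwise_of_maps_to hmem, ← Finset.sum_fiberwise_of_maps_to hmem]
  refine Finset.sum_le_sum fun p hp => ?_
  obtain ⟨v₀, -, rfl⟩ := Finset.mem_image.1 hp
  have key : ∀ z : V → ℝ, ∑ v with π v = π v₀, g v * z v = g v₀ * ∑ v with π v = π v₀, z v := by
    intro z
    rw [Finset.mul_sum]
    refine Finset.sum_congr rfl fun v hv => ?_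
    rw [hπ v v₀ (Finset.mem_filter.1 hv).2]
  rw [key, key]
  exact mul_le_mul_of_nonneg_left (h v₀) (hg v₀)

theorem agree_of_lt [Fintype ι] {n : ℕ} {σ : ι ≃ Fin n} {v v' : ∀ i, Ω i} {i : ι}
    (h : ∀ j, σ j < σ i → v j = v' j) :
    (fun j : (completeGraph σ).pa i => v j) = fun j : (completeGraph σ).pa i => v' j := by
  funext j
  exact h j (by simpa [completeGraph] using j.2)

theorem mem_credal_of_mem_params [Fintype ι] [∀ i, Fintype (Ω i)]
    {N : CredalBN ι Ω} {n : ℕ} {σ : ι ≃ Fin n} {hσ : N.toBNGraph.IsTopologicalOrder σ}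
    {Θ : (completeGraph σ).Params Ω}
    (hΘ : Θ ∈ (N.maximalEnrichment σ hσ).params) (v : ∀ i, Ω i) (i : ι) :
    Θ i (fun j => v j) ∈ N.credal i (fun j => v j) :=
  hΘ i (fun j => v j)

/-! ### Weights of the circuit versus members of the maximal enrichment -/

section Enrichment

variable [Fintype ι] [DecidableEq ι] [∀ i, Fintype (Ω i)]
  {N : CredalBN ι Ω} {n : ℕ} {σ : ι ≃ Fin n} {hσ : N.toBNGraph.IsTopologicalOrder σ}
  {T : AC N.toBNGraph Ω} {sp : AC.Splitting T}

/-- The weights of the circuit are conditional probabilities of the maximal enrichment. -/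
theorem exists_params_of_weights [∀ i, Nonempty (Ω i)] (hT : AC.Computes T sp σ)
    {W : ∀ s : T.SumNode, T.Branch s → ℝ} (hW : W ∈ AC.credalWeights N T sp) :
    ∃ Θ : (completeGraph σ).Params Ω, Θ ∈ (N.maximalEnrichment σ hσ).params ∧
      ∀ v, ∀ c ∈ (sp.chosen v T.root).choices,
        W c.1 c.2 = Θ (sp.var c.1) (fun j => v j) (v (sp.var c.1)) := by
  have key : ∀ i (u : (completeGraph σ).ParentInst Ω i),
      ∃ θ ∈ (N.maximalEnrichment σ hσ).credal i u, ∀ v : ∀ i, Ω i,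
        (fun j : (completeGraph σ).pa i => v j) = u →
        ∀ c ∈ (sp.chosen v T.root).choices, sp.var c.1 = i → W c.1 c.2 = θ (v i) := by
    intro i u
    by_cases h : ∃ v₀ : ∀ i, Ω i, (fun j : (completeGraph σ).pa i => v₀ j) = u ∧
        ∃ c ∈ (sp.chosen v₀ T.root).choices, sp.var c.1 = i
    · obtain ⟨v₀, rfl, c₀, hc₀, rfl⟩ := h
      obtain ⟨θ, hθ, hWθ⟩ := hW c₀.1
      rw [hT.credal_parentValues hσ ⟨c₀.2, hc₀⟩] at hθ
      refine ⟨θ, hθ, fun v hv c hc hci => ?_⟩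
      -- The past `u` determines the node that splits on `i`, so the vector taken from `v₀` serves
      -- every `v` with this past.
      obtain ⟨b, hb⟩ := hT.visits_of_agree (v' := v) (fun j hj => (congrFun hv
        ⟨j, by simpa [completeGraph] using hj⟩).symm) ⟨c₀.2, hc₀⟩
      obtain rfl := hT.choice_unique hc hb hci
      rw [hWθ, sp.val_of_mem_chosen _ hb]
    -- No node splits on `i` after the past `u`; any member of the credal set will do.
    · obtain ⟨θ, hθ⟩ := (N.maximalEnrichment σ hσ).credal_nonempty i u
      exact ⟨θ, hθ, fun v hv c hc hci => (h ⟨v, hv, c, hc, hci⟩).elim⟩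
  choose Θ hΘ h using key
  exact ⟨Θ, hΘ, fun v c hc => h _ _ v rfl c hc rfl⟩

theorem value_root_eq_expectation (hT : AC.Computes T sp σ)
    {W : ∀ s : T.SumNode, T.Branch s → ℝ} {Θ : (completeGraph σ).Params Ω}
    (hΘ : Θ ∈ (N.maximalEnrichment σ hσ).params)
    (h : ∀ v, ∀ c ∈ (sp.chosen v T.root).choices,
      W c.1 c.2 = Θ (sp.var c.1) (fun j => v j) (v (sp.var c.1))) (lam : ∀ i, Ω i → ℝ) :
    Circuit.value (AC.leafValue lam) W T.root = (completeGraph σ).expectation Θ lam := by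
  rw [hT.value_root]
  refine Finset.sum_congr rfl fun v _ => ?_
  rw [Multiset.map_congr rfl (h v), hT.prod_choices v (fun i => Θ i (fun j => v j) (v i))]
  intro i _
  exact N.eq_one_of_subsingleton (mem_credal_of_mem_params hΘ v i) _

/-- If the circuit follows `v₀` for the variables before position `k` and has the conditional
probabilities `Θ` at the later ones, then it sums over the instantiations that agree with `v₀` on
the former. -/
theorem value_root_of_prefix (hT : AC.Computes T sp σ) {k : ℕ} (v₀ : ∀ i, Ω i)
    {W : ∀ s : T.SumNode, T.Branch s → ℝ} {Θ : (completeGraph σ).Params Ω}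
    (hΘ : Θ ∈ (N.maximalEnrichment σ hσ).params)
    (hlt : ∀ s b, (σ (sp.var s) : ℕ) < k →
      W s b = open Classical in if sp.val s b = v₀ (sp.var s) then 1 else 0)
    (hge : ∀ v : ∀ i, Ω i, (∀ i, (σ i : ℕ) < k → v i = v₀ i) →
      ∀ c ∈ (sp.chosen v T.root).choices, k ≤ (σ (sp.var c.1) : ℕ) →
        W c.1 c.2 = Θ (sp.var c.1) (fun j => v j) (v (sp.var c.1))) (lam : ∀ i, Ω i → ℝ) :
    Circuit.value (AC.leafValue lam) W T.root =
      open Classical in ∑ v : (∀ i, Ω i) with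
          ((fun i : {i // (σ i : ℕ) < k} => v i) = fun i : {i // (σ i : ℕ) < k} => v₀ i),
        (∏ i, lam i (v i)) *
          ∏ i, if (σ i : ℕ) < k then 1 else Θ i (fun j => v j) (v i) := by
  classical
  rw [hT.value_root, Finset.sum_filter]
  refine Finset.sum_congr rfl fun v _ => ?_
  split_ifs with hv
  · have hv' : ∀ i, (σ i : ℕ) < k → v i = v₀ i := fun i hi => congrFun hv ⟨i, hi⟩
    congr 1
    rw [← hT.prod_choices v]
    · congr 1
      refine Multiset.map_congr rfl fun c hc => ?_
      split_ifs with hk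
      · rw [hlt _ _ hk, if_pos ((sp.val_of_mem_chosen c hc).trans (hv' _ hk))]
      · exact hge v hv' c hc (not_lt.1 hk)
    · intro i _
      split_ifs
      · rfl
      · exact N.eq_one_of_subsingleton (mem_credal_of_mem_params hΘ v i) _
  · obtain ⟨⟨i, hi⟩, hne⟩ := Function.ne_iff.1 hv
    -- If `v` deviates from `v₀` at an early variable, that variable has two values, so it is split
    -- on and the deviating branch has weight `0`.
    have : Nontrivial (Ω i) := ⟨_, _, hne⟩
    obtain ⟨c, hc, rfl⟩ := hT.exists_choice v i
    rw [Multiset.prod_eq_zero, mul_zero]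
    refine Multiset.mem_map.2 ⟨c, hc, ?_⟩
    rw [hlt _ _ hi, if_neg]
    rwa [sp.val_of_mem_chosen c hc]

/-- Every member of the maximal enrichment is dominated by some weights of the circuit. -/
theorem exists_weights_of_params [∀ i, Nonempty (Ω i)]
    (hT : AC.Computes T sp σ) {Θ : (completeGraph σ).Params Ω}
    (hΘ : Θ ∈ (N.maximalEnrichment σ hσ).params) {lam : ∀ i, Ω i → ℝ}
    (hlam : ∀ i x, 0 ≤ lam i x) :
    ∃ W ∈ AC.credalWeights N T sp, (completeGraph σ).expectation Θ lam ≤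
      Circuit.value (AC.leafValue lam) W T.root := by
  classical
  choose θ₀ hθ₀ using fun s => N.credal_nonempty (sp.var s) (AC.parentValues T sp s)
  -- The candidates at `s` are the vectors of `Θ` over all visiting instantiations: a finite set
  -- even if the credal sets are infinite or not closed. The vector `θ₀ s` keeps it nonempty at
  -- unvisited nodes.
  obtain ⟨W, hWF, hopt⟩ := Circuit.exists_optimal_weights (AC.leafValue lam)
    (fun s : T.SumNode => insert (fun b => θ₀ s (sp.val s b))
      ((fun (v : ∀ i, Ω i) b => Θ (sp.var s) (fun j => v j) (sp.val s b)) '' {v | sp.Visits v s}))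
    (fun s => (Set.toFinite _).insert _) (fun s => Set.insert_nonempty _ _)
  have hW : W ∈ AC.credalWeights N T sp := by
    intro s
    rcases hWF s with h | ⟨v, hv, h⟩
    · exact ⟨_, hθ₀ s, fun b => congrFun h b⟩
    · refine ⟨_, ?_, fun b => (congrFun h b).symm⟩
      rw [hT.credal_parentValues hσ hv]
      exact mem_credal_of_mem_params hΘ v _
  refine ⟨W, hW, ?_⟩
  have hW0 : ∀ s b, 0 ≤ W s b := fun s b => by
    obtain ⟨θ, hθ, h⟩ := hW s
    rw [h]
    exact (N.credal_subset _ _ hθ).1 _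
  obtain ⟨Θ', hΘ', hWΘ'⟩ := exists_params_of_weights (hσ := hσ) hT hW
  rw [value_root_eq_expectation hT hΘ' hWΘ']
  -- Interpolation between `Θ'` at `k = 0` and `Θ` at `k = n`.
  let hyb : ℕ → (completeGraph σ).Params Ω := fun k i u =>
    if (σ i : ℕ) < k then Θ i u else Θ' i u
  have hhyb : ∀ k, hyb k ∈ (N.maximalEnrichment σ hσ).params := fun k i u => by
    simp only [hyb]
    split_ifs
    exacts [hΘ i u, hΘ' i u]
  have step : ∀ k, (completeGraph σ).expectation (hyb (k + 1)) lam ≤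
      (completeGraph σ).expectation (hyb k) lam := by
    intro k
    -- Needed for `k' = k` and `k' = k + 1`: both hybrids use `Θ` before position `k`, so they share
    -- the first factor, which depends only on the past.
    have split : ∀ k', k ≤ k' → (completeGraph σ).expectation (hyb k') lam =
        ∑ v : ∀ i, Ω i, (∏ i, if (σ i : ℕ) < k then Θ i (fun j => v j) (v i) else 1) *
          ((∏ i, lam i (v i)) *
            ∏ i, if (σ i : ℕ) < k then 1 else hyb k' i (fun j => v j) (v i)) := by
      intro k' hk'
      refine Finset.sum_congr rfl fun v _ => ?_
      rw [mul_left_comm]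
      congr 1
      rw [← Finset.prod_mul_distrib]
      refine Finset.prod_congr rfl fun i _ => ?_
      by_cases hi : (σ i : ℕ) < k
      · simp [hyb, hi, hi.trans_le hk']
      · simp [hi]
    rw [split k le_rfl, split (k + 1) k.le_succ]
    refine sum_mul_le_sum_mul_of_fiber
      (fun (v : ∀ i, Ω i) (i : {i // (σ i : ℕ) < k}) => v i) (fun v => ?_) (fun v v' h => ?_)
      fun v₀ => ?_
    · refine Finset.prod_nonneg fun i _ => ?_
      split_ifs
      · exact (N.credal_subset _ _ (mem_credal_of_mem_params hΘ v i)).1 _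
      · exact zero_le_one
    · have h' : ∀ i, (σ i : ℕ) < k → v i = v' i := fun i hi => congrFun h ⟨i, hi⟩
      refine Finset.prod_congr rfl fun i _ => ?_
      split_ifs with hi
      · rw [agree_of_lt (v := v) (v' := v') fun j hj => h' j (lt_trans hj hi), h' i hi]
      · rfl
    -- `U` forces the past `v₀` and is optimal from position `k` on; `U'` differs from it only at
    -- the nodes at position `k` that `v₀` visits, where it uses `Θ`. Their root values are the two
    -- sums over the fibre of `v₀`.
    · let U : ∀ s : T.SumNode, T.Branch s → ℝ := fun s b =>
        if (σ (sp.var s) : ℕ) < k then (if sp.val s b = v₀ (sp.var s) then 1 else 0) else W s b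
      let U' : ∀ s : T.SumNode, T.Branch s → ℝ := fun s b =>
        if (σ (sp.var s) : ℕ) = k ∧ sp.Visits v₀ s then
          Θ (sp.var s) (fun j => v₀ j) (sp.val s b) else U s b
      have hU0 : ∀ s b, 0 ≤ U s b := fun s b => by
        simp only [U]
        split_ifs
        exacts [zero_le_one, le_rfl, hW0 s b]
      have hU : ∀ s, (σ (sp.var s) : ℕ) = k → ∀ b,
          Circuit.value (AC.leafValue lam) U (T.child s b) =
            Circuit.value (AC.leafValue lam) W (T.child s b) := by
        intro s hs b
        -- Everything below `s` splits after position `k`, where `U` and `W` coincide.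
        refine Circuit.value_congr fun s' hs' => funext fun b' => if_neg ?_
        have := hT.ordered s s' (.head' ⟨b, rfl⟩ hs')
        rw [← hs]
        exact not_lt.2 this.le
      have hle := Circuit.value_le_value (f := AC.leafValue lam) (W := U') (W' := U)
        (AC.leafValue_nonneg hlam) (fun s b => ?_) (fun s => ?_) T.root
      · rw [value_root_of_prefix hT v₀ (hhyb k) (W := U), value_root_of_prefix hT v₀ (hhyb (k + 1))
          (W := U')] at hle
        · exact hle
        · intro s b hs
          simp only [U', hs.ne, false_and, if_false, U, hs, if_true]
        · intro v hv c hc hk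
          have hval := sp.val_of_mem_chosen c hc
          by_cases hck : (σ (sp.var c.1) : ℕ) = k
          · have hag : ∀ j, σ j < σ (sp.var c.1) → v j = v₀ j :=
              fun j hj => hv j (lt_of_lt_of_eq hj hck)
            have hvis : sp.Visits v₀ c.1 := hT.visits_of_agree hag ⟨c.2, hc⟩
            simp only [U', hck, hvis, and_self, if_true, hval, hyb, Nat.lt_succ_self]
            rw [agree_of_lt hag]
          · have h1 : ¬ (σ (sp.var c.1) : ℕ) < k + 1 := by omega
            simp only [U', hck, false_and, if_false, U, not_lt.2 hk, hyb, h1]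
            exact hWΘ' v c hc
        · intro s b hs
          simp only [U, hs, if_true]
        · intro v hv c hc hk
          simp only [U, not_lt.2 hk, if_false, hyb]
          exact hWΘ' v c hc
      · simp only [U']
        split_ifs
        · exact (N.credal_subset _ _ (mem_credal_of_mem_params hΘ v₀ _)).1 _
        · exact hU0 s b
      · by_cases hs : (σ (sp.var s) : ℕ) = k ∧ sp.Visits v₀ s
        · have h1 : ∀ b, U s b = W s b := fun b => if_neg hs.1.not_lt
          simp only [U', hs, and_self, if_true, hU s hs.1, h1]
          -- The vector of `Θ` after the past `v₀` was a candidate at `s`, so it does not beat the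
          -- optimal one.
          exact hopt s _ (.inr ⟨v₀, hs.2, rfl⟩)
        · simp only [U', hs, if_false, le_refl]
  have hanti : Antitone fun k => (completeGraph σ).expectation (hyb k) lam :=
    antitone_nat_of_succ_le step
  have h0 : hyb 0 = Θ' := by
    funext i u
    simp [hyb]
  have hn : hyb n = Θ := by
    funext i u
    simp [hyb]
  have := hanti (Nat.zero_le n)
  simpa only [h0, hn] using this

end Enrichment

/-! ### Compactness, attainment and the final comparison -/

/-- The probabilities of an event under closed sets of probability vectors form a compact set. -/
theorem BNGraph.isCompact_prob_image [Fintype ι] [DecidableEq ι] [∀ i, Fintype (Ω i)]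
    (G : BNGraph ι) (C : ∀ i, G.ParentInst Ω i → Set (Ω i → ℝ)) (hC : ∀ i u, IsClosed (C i u))
    (hsub : ∀ i u, C i u ⊆ stdSimplex ℝ (Ω i)) {E : Finset ι} (e : ∀ i : E, Ω i) :
    IsCompact ((fun Θ : G.Params Ω => G.prob Θ e) '' {Θ | ∀ i u, Θ i u ∈ C i u}) := by
  have h1 : IsCompact {Θ : G.Params Ω | ∀ i u, Θ i u ∈ C i u} := by
    have := isCompact_univ_pi fun i => isCompact_univ_pi fun u =>
      (isCompact_stdSimplex ℝ (Ω i)).of_isClosed_subset (hC i u) (hsub i u)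
    convert this using 1
    ext Θ
    simp
  refine h1.image ?_
  refine continuous_finsetSum _ fun v _ => ?_
  split_ifs
  · fun_prop
  · exact continuous_const

theorem isGreatest_iff_of_dominated {A B : Set ℝ} (hAB : A ⊆ B) (h : ∀ b ∈ B, ∃ a ∈ A, b ≤ a)
    (m : ℝ) : IsGreatest A m ↔ IsGreatest B m := by
  constructor
  · rintro ⟨hm, hub⟩
    refine ⟨hAB hm, fun b hb => ?_⟩
    obtain ⟨a, ha, hba⟩ := h b hb
    exact hba.trans (hub ha)
  · rintro ⟨hm, hub⟩
    obtain ⟨a, ha, hma⟩ := h m hm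
    rw [le_antisymm hma (hub (hAB ha))]
    exact ⟨ha, fun a' ha' => (hub (hAB ha')).trans hma⟩

end

end CredalNet

theorem theorem2 {ι : Type*} [Fintype ι] [DecidableEq ι]
    {Ω : ι → Type*} [∀ i, Fintype (Ω i)] [∀ i, Nonempty (Ω i)]
    -- a credal Bayesian network and a topological order of its variables
    (N : CredalNet.CredalBN ι Ω) {n : ℕ} (σ : ι ≃ Fin n)
    (hσ : N.toBNGraph.IsTopologicalOrder σ)
    -- any arithmetic circuit that computes the network respecting the order
    (T : CredalNet.AC N.toBNGraph Ω) (sp : CredalNet.AC.Splitting T)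
    (hT : CredalNet.AC.Computes T sp σ)
    -- an instantiation of a subset of the variables
    {E : Finset ι} (e : ∀ i : E, Ω i) :
    let S := CredalNet.AC.compileCredal N T sp hT.root_not_isParam
    let Nplus := N.maximalEnrichment σ hσ
    S.marMax e = Nplus.marMax e ∧
      -- both numbers are genuine suprema, and one is attained exactly if the other is
      IsLUB (S.marValues e) (S.marMax e) ∧
      IsLUB (Nplus.marValues e) (Nplus.marMax e) ∧
      (∀ m, IsGreatest (S.marValues e) m ↔ IsGreatest (Nplus.marValues e) m) ∧
      -- they are maxima as soon as the credal sets are closed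
      ((∀ i u, IsClosed (N.credal i u)) →
        IsGreatest (S.marValues e) (S.marMax e) ∧
        IsGreatest (Nplus.marValues e) (Nplus.marMax e)) := by
  classical
  intro S Nplus
  have hS : S.marValues e = _ :=
    CredalNet.AC.marValues_compileCredal N T sp hT.root_not_isParam e
  have hsub : S.marValues e ⊆ Nplus.marValues e := by
    rw [hS]
    rintro _ ⟨W, hW, rfl⟩
    obtain ⟨Θ, hΘ, h⟩ := CredalNet.exists_params_of_weights (hσ := hσ) hT hW
    exact ⟨Θ, hΘ, (CredalNet.BNGraph.prob_eq_expectation _ _ _).trans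
      (CredalNet.value_root_eq_expectation hT hΘ h _).symm⟩
  have hdom : ∀ y ∈ Nplus.marValues e, ∃ x ∈ S.marValues e, y ≤ x := by
    rintro _ ⟨Θ, hΘ, rfl⟩
    obtain ⟨W, hW, h⟩ := CredalNet.exists_weights_of_params (hσ := hσ) hT hΘ
      (CredalNet.eventIndicators_nonneg e)
    rw [hS]
    exact ⟨_, ⟨W, hW, rfl⟩, (CredalNet.BNGraph.prob_eq_expectation _ _ _).trans_le h⟩
  have hiff := CredalNet.isGreatest_iff_of_dominated hsub hdom
  have hNne : (Nplus.marValues e).Nonempty := by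
    choose Θ hΘ using Nplus.credal_nonempty
    exact ⟨_, Θ, hΘ, rfl⟩
  have hSne : (S.marValues e).Nonempty := by
    obtain ⟨y, hy⟩ := hNne
    obtain ⟨x, hx, -⟩ := hdom y hy
    exact ⟨x, hx⟩
  have hbdd : BddAbove (Nplus.marValues e) := by
    -- Boundedness holds for arbitrary credal sets: enlarge each one to the full simplex.
    refine (CredalNet.BNGraph.isCompact_prob_image Nplus.toBNGraph
      (fun i _ => stdSimplex ℝ (Ω i)) (fun i _ => isClosed_stdSimplex _ _)
      (fun _ _ => subset_rfl) e).bddAbove.mono ?_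
    rintro _ ⟨Θ, hΘ, rfl⟩
    exact ⟨Θ, fun i u => Nplus.credal_subset i u (hΘ i u), rfl⟩
  have hlubN : IsLUB (Nplus.marValues e) (Nplus.marMax e) := isLUB_csSup hNne hbdd
  have hlubS : IsLUB (S.marValues e) (S.marMax e) := isLUB_csSup hSne (hbdd.mono hsub)
  refine ⟨?_, hlubS, hlubN, hiff, fun hcl => ?_⟩
  · refine le_antisymm (hlubS.2 fun x hx => hlubN.1 (hsub hx)) (hlubN.2 fun y hy => ?_)
    obtain ⟨x, hx, hyx⟩ := hdom y hy
    exact hyx.trans (hlubS.1 hx)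
  · have hcomp : IsCompact (Nplus.marValues e) :=
      CredalNet.BNGraph.isCompact_prob_image Nplus.toBNGraph Nplus.credal
        (fun i _ => hcl i _) Nplus.credal_subset e
    have hN : IsGreatest (Nplus.marValues e) (Nplus.marMax e) := hcomp.isGreatest_sSup hNne
    -- Attainment is transferred from the enrichment by domination, so no compactness argument is
    -- needed for the circuit.
    have hSg := (hiff _).2 hN
    exact ⟨hlubS.unique hSg.isLUB ▸ hSg, hN⟩
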